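/- Let $\Bbbk$ be an algebraically closed field, let $G$ be an affine algebraic group over $\Bbbk$ with Hopf algebra of polynomial functions $\Bbbk[G]$ (a finitely generated, reduced, commutative Hopf algebra), and let $H\subseteq G$ be a closed subgroup, with restriction map $\pi:\Bbbk[G]\to\Bbbk[H]$. A rational $H$-module is a right $\Bbbk[H]$-comodule $\chi:M\to M\otimes\Bbbk[H]$, $\chi(m)=\sum m_0\otimes m_1$, on which $x\in H$ acts by $x\cdot m=\sum m_0\,m_1(x)$; write ${}^HM=\{m\in M: x\cdot m=m \text{ for all } x\in H\}$. In particular $H$ acts on $\Bbbk[H]$ and on $\Bbbk[G]$ by $(x\cdot f)(y)=f(yx)$. A $(\Bbbk[G],H)$-module is a $\Bbbk[G]$-module $M$ that is also a rational $H$-module (with the same underlying $\Bbbk$-vector space) such that $x\cdot(rm)=(x\cdot r)(x\cdot m)$ for all $x\in H$, $r\in\Bbbk[G]$, $m\in M$; morphisms are the $\Bbbk[G]$-linear $H$-equivariant maps. The homogeneous space $G/H$ is the set of cosets $xH$ with the quotient topology of the Zariski topology of $G$, a function on an open set $U\subseteq G/H$ being regular if its composition with the projection $p:G\to G/H$ is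 regular on $p^{-1}(U)$. The following three conditions are equivalent: \begin{enumerate} \item $H$ is exact in $G$: for every short exact sequence $0\to P\to Q\to R\to 0$ of $(\Bbbk[G],H)$-modules, the sequence $0\to{}^HP\to{}^HQ\to{}^HR\to 0$ is exact. \item The homogeneous space $G/H$ is affine, i.e. isomorphic, as a space with functions, to an affine variety (the variety of a finitely generated reduced commutative $\Bbbk$-algebra). \item There is a total integral $\sigma:\Bbbk[H]\to\Bbbk[G]$, i.e. a $\Bbbk$-linear map with $\sigma(x\cdot f)=x\cdot\sigma(f)$ for all $x\in H$, $f\in\Bbbk[H]$, and $\sigma(1)=1$. \end{enumerate} -/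

import Mathlib

/-!
Affine algebraic groups over an algebraically closed field `k` are given by their Hopf algebras of
polynomial functions: finitely generated, reduced, commutative Hopf algebras `A = k[G]`, the
abstract group `G` being the group of `k`-algebra homomorphisms `A → k` under convolution.
A closed inclusion `H ⊆ G` is given by its restriction map, a surjective homomorphism
`π : k[G] → k[H]` of Hopf algebras.
-/

open scoped TensorProduct

universe u

namespace Observability

noncomputable section

/-- The set of points of the affine variety with coordinate algebra `C`.  If `C = k[G]` is a Hopf
algebra, this is the group `G`, with product characterised by `f (x y) = ∑ f₁ (x) f₂ (y)`; the
group structure is Mathlib's convolution group. -/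
abbrev Points (k C : Type u) [Field k] [CommRing C] [Algebra k C] : Type u :=
  WithConv (C →ₐ[k] k)

section Varieties

variable {k C : Type u} [Field k] [CommRing C] [Algebra k C]

/-- The maximal ideal of functions vanishing at `x`, as a point of the prime spectrum. -/
def Points.toPrimeSpectrum (x : Points k C) : PrimeSpectrum C :=
  ⟨RingHom.ker x.ofConv, RingHom.ker_isPrime _⟩

/-- The Zariski topology on the set of points. -/
instance Points.zariskiTopology : TopologicalSpace (Points k C) :=
  TopologicalSpace.induced Points.toPrimeSpectrum inferInstance

/-- The function `f` is regular on the subset `U` (used for `U` open) of an affine variety: near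
every point of `U` it is a quotient of two polynomial functions.  Only the values of `f` on `U`
matter. -/
def IsRegularOn (U : Set (Points k C)) (f : Points k C → k) : Prop :=
  ∀ x ∈ U, ∃ a s : C, x s ≠ 0 ∧ ∀ y ∈ U, y s ≠ 0 → f y = y a / y s

/-- A space with functions, i.e. a topological space `X` with a notion `reg U f` of `k`-valued
function `f` regular on the open set `U`, is affine if it is isomorphic to the affine variety of
some finitely generated reduced commutative `k`-algebra: there is a homeomorphism which, over each
open set, identifies the regular functions. -/
def IsAffineSpace (k : Type u) [Field k] (X : Type u) [TopologicalSpace X]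
    (reg : Set X → (X → k) → Prop) : Prop :=
  ∃ (C : Type u) (_ : CommRing C) (_ : Algebra k C),
    Algebra.FiniteType k C ∧ IsReduced C ∧
      ∃ e : X ≃ₜ Points k C, ∀ U : Set (Points k C), IsOpen U →
        ∀ f : Points k C → k, IsRegularOn U f ↔ reg (e ⁻¹' U) (f ∘ e)

end Varieties

section Comodules

variable {k A B : Type u} [Field k] [CommRing A] [HopfAlgebra k A] [CommRing B] [HopfAlgebra k B]

/-- A structure of rational `H`-module on the vector space `M`: a right comodule structure
`χ : M → M ⊗ B` over `B = k[H]`. -/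
structure RationalAction (k B : Type u) [Field k] [CommRing B] [HopfAlgebra k B]
    (M : Type u) [AddCommGroup M] [Module k M] where
  coact : M →ₗ[k] M ⊗[k] B
  coassoc : (TensorProduct.assoc k M B B).toLinearMap ∘ₗ coact.rTensor B ∘ₗ coact =
    (Coalgebra.comul (R := k) (A := B)).lTensor M ∘ₗ coact
  counit_comp : (TensorProduct.rid k M).toLinearMap ∘ₗ
    (Coalgebra.counit (R := k) (A := B)).lTensor M ∘ₗ coact = LinearMap.id

namespace RationalAction

variable {M : Type u} [AddCommGroup M] [Module k M]

/-- The action of the group: `x · m = ∑ m₀ m₁(x)`, where `χ m = ∑ m₀ ⊗ m₁`. -/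
def act (ρ : RationalAction k B M) (x : Points k B) : M →ₗ[k] M :=
  (TensorProduct.rid k M).toLinearMap ∘ₗ x.ofConv.toLinearMap.lTensor M ∘ₗ ρ.coact

/-- The elements of `M` fixed by all the elements of the group. -/
def invariants (ρ : RationalAction k B M) : Submodule k M where
  carrier := {m | ∀ x : Points k B, ρ.act x m = m}
  add_mem' hm hn x := by rw [map_add, hm x, hn x]
  zero_mem' x := map_zero _
  smul_mem' c m hm x := by rw [map_smul, hm x]

/-- The algebra `k[G]` as a rational `G`-module, `x · f = ∑ f₁ f₂(x)`. -/
def regular (k B : Type u) [Field k] [CommRing B] [HopfAlgebra k B] : RationalAction k B B where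
  coact := Coalgebra.comul
  coassoc := Coalgebra.coassoc
  counit_comp := by
    ext b
    simp

/-- Restriction `N|_H` of a rational `G`-module to `H`: the coaction becomes
`∑ n₀ ⊗ π (n₁)`. -/
def restrict (π : A →ₐc[k] B) (ρ : RationalAction k A M) : RationalAction k B M where
  coact := (π : A →ₗ[k] B).lTensor M ∘ₗ ρ.coact
  coassoc := by
    have hπ : TensorProduct.map (π : A →ₗ[k] B) (π : A →ₗ[k] B) ∘ₗ Coalgebra.comul =
        Coalgebra.comul ∘ₗ (π : A →ₗ[k] B) := CoalgHomClass.map_comp_comul π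
    rw [← LinearMap.comp_assoc _ _ (Coalgebra.comul.lTensor M), ← LinearMap.lTensor_comp, ← hπ,
      LinearMap.lTensor_comp, LinearMap.comp_assoc, ← ρ.coassoc]
    simp only [← LinearMap.comp_assoc]
    congr 1
    rw [LinearMap.rTensor_comp]
    simp only [LinearMap.comp_assoc]
    have h₁ : ρ.coact.rTensor B ∘ₗ (π : A →ₗ[k] B).lTensor M =
        (π : A →ₗ[k] B).lTensor (M ⊗[k] A) ∘ₗ ρ.coact.rTensor A := by
      rw [LinearMap.rTensor_comp_lTensor, LinearMap.lTensor_comp_rTensor]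
    rw [h₁]
    simp only [← LinearMap.comp_assoc]
    congr 1
    ext m a b
    simp
  counit_comp := by
    have hπ : Coalgebra.counit ∘ₗ (π : A →ₗ[k] B) = Coalgebra.counit :=
      CoalgHomClass.counit_comp π
    rw [← LinearMap.comp_assoc _ _ (Coalgebra.counit.lTensor M), ← LinearMap.lTensor_comp, hπ,
      ρ.counit_comp]

end RationalAction

/-- The rational `H`-module structure of `k[G]`, the restriction of the one of the `G`-module
`k[G]`. -/
def coordinateAction (π : A →ₐc[k] B) : RationalAction k B A :=
  (RationalAction.regular k A).restrict π

/-- A `(k[G], H)`-module: a `k[G]`-module which is a rational `H`-module (over the same vector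
space structure) with `x · (r m) = (x · r) (x · m)` for `x ∈ H`, `r ∈ k[G]`. -/
structure EquivariantModule (π : A →ₐc[k] B) where
  carrier : Type u
  [addCommGroup : AddCommGroup carrier]
  [moduleBase : Module k carrier]
  [module : Module A carrier]
  [isScalarTower : IsScalarTower k A carrier]
  action : RationalAction k B carrier
  act_smul : ∀ (x : Points k B) (r : A) (m : carrier),
    action.act x (r • m) = (coordinateAction π).act x r • action.act x m

namespace EquivariantModule

attribute [instance] addCommGroup moduleBase module isScalarTower

variable {π : A →ₐc[k] B}

/-- The subspace of `H`-invariants of a `(k[G], H)`-module. -/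
abbrev invariants (M : EquivariantModule π) : Submodule k M.carrier :=
  M.action.invariants

/-- A morphism of `(k[G], H)`-modules: a `k[G]`-linear and `H`-equivariant map. -/
structure Hom (M N : EquivariantModule π) where
  toLinearMap : M.carrier →ₗ[A] N.carrier
  map_act : ∀ (x : Points k B) (m : M.carrier),
    toLinearMap (M.action.act x m) = N.action.act x (toLinearMap m)

/-- The map induced on the invariants by a morphism. -/
def Hom.onInvariants {M N : EquivariantModule π} (f : Hom M N) (m : M.invariants) :
    N.invariants :=
  ⟨f.toLinearMap m, fun x => by rw [← f.map_act, m.2 x]⟩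

end EquivariantModule

/-- The closed subgroup `H` is exact in `G`: for every short exact sequence `0 → P → Q → R → 0` of
`(k[G], H)`-modules the sequence of invariants is exact. -/
def IsExactSubgroup (π : A →ₐc[k] B) : Prop :=
  ∀ (P Q R : EquivariantModule π) (f : P.Hom Q) (g : Q.Hom R),
    Function.Injective f.toLinearMap → Function.Exact f.toLinearMap g.toLinearMap →
      Function.Surjective g.toLinearMap →
    Function.Injective f.onInvariants ∧ Function.Exact f.onInvariants g.onInvariants ∧
      Function.Surjective g.onInvariants

/-- A total integral for `H` with values in `k[G]`: an `H`-equivariant linear map `k[H] → k[G]`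
that maps `1` to `1`. -/
structure IsTotalIntegral (π : A →ₐc[k] B) (σ : B →ₗ[k] A) : Prop where
  map_act : ∀ (x : Points k B) (f : B),
    σ ((RationalAction.regular k B).act x f) = (coordinateAction π).act x (σ f)
  map_one : σ 1 = 1

/-- The inclusion `H → G` of groups of points. -/
def inclusion (π : A →ₐc[k] B) : Points k B →* Points k A where
  toFun x := WithConv.toConv (x.ofConv.comp (π : A →ₐ[k] B))
  map_one' := by
    ext a
    simp
  map_mul' x y := by
    apply WithConv.ofConv_injective
    exact AlgHom.convMul_comp_bialgHom_distrib x y π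

/-- `H` as a subgroup of `G`. -/
abbrev subgroup (π : A →ₐc[k] B) : Subgroup (Points k A) :=
  (inclusion π).range

/-- The homogeneous space `G/H`, the set of cosets `xH` with the quotient topology. -/
abbrev HomogeneousSpace (π : A →ₐc[k] B) : Type u :=
  Points k A ⧸ subgroup π

/-- The structure sheaf of `G/H`: a function on an open subset `U` of `G/H` is regular if its
composition with the projection `G → G/H` is regular on the inverse image of `U`. -/
def IsRegularOnQuotient (π : A →ₐc[k] B) (U : Set (HomogeneousSpace π))
    (f : HomogeneousSpace π → k) : Prop :=
  IsRegularOn ((fun x : Points k A => (x : HomogeneousSpace π)) ⁻¹' U)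
    (fun x : Points k A => f (x : HomogeneousSpace π))

/-- The homogeneous space `G/H` is an affine variety. -/
def IsAffineHomogeneousSpace (π : A →ₐc[k] B) : Prop :=
  IsAffineSpace k (HomogeneousSpace π) (IsRegularOnQuotient π)

end Comodules

end

end Observability

/-! The hub is the averaging operator attached to a linear map `σ : k[H] → k[G]`, sending an element
`m` of a `(k[G], H)`-module to `∑ σ(S m₁) m₀`. If `σ` is equivariant and `σ 1 = 1`, this is a
natural projection onto the invariants, so invariants lift along surjections. For a given `m` only
finitely many values of `σ` matter; hence `HasLocalIntegrals`, equivariance on prescribed finite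
sets, already implies exactness.

Exactness yields a total integral by Zorn's lemma on partially defined equivariant maps extending `1
↦ 1`. For finite dimensional stable `N ≤ N'` in `k[H]`, restriction `Hom(N', k[G]) → Hom(N, k[G])`
is a surjection of `(k[G], H)`-modules whose invariants are the equivariant maps, so these extend
(`IsExactSubgroup.exists_extend`).

Given a total integral, averaging on `k[G]` is a Reynolds operator, linear over the invariants. It
makes points of `k[G]^H` lift to `G` and lets invariants separate a coset from a disjoint closed
`H`-stable set, so `G/H` is the variety of `k[G]^H`. Finite generation holds after inverting some
nonzero invariant `f`; the left translates of `f` generate the unit ideal of `k[G]`, and the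
Reynolds operator moves this relation into `k[G]^H`, where finite generation glues.

If `G/H` is affine, local integrals come from equivariant maps `k[G] → k[G]` that fix `1` and kill
`W = V ∩ ker π`, with `V` finite dimensional and stable: they descend to `π(V)`. A determinant in
left translates of a basis of `W` gives such a map up to a character, nonzero at `1`
(`exists_semiequivariant`). Affineness supplies an invariant function that cancels the character,
and the values at `1` of the corrected maps form an ideal of functions on `G/H` without common zero.
-/

namespace Observability

noncomputable section

/-! ### Nullstellensatz, regular functions and tensors as polynomial maps -/

section Points

variable {k C : Type u} [Field k] [CommRing C] [Algebra k C]

/-- **Nullstellensatz**: a maximal ideal of a finitely generated algebra is the ideal of a point. -/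
lemma exists_point_ker_eq [IsAlgClosed k] [Algebra.FiniteType k C] (m : Ideal C) [hm : m.IsMaximal] :
    ∃ x : Points k C, ∀ a : C, x a = 0 ↔ a ∈ m := by
  let _ : Field (C ⧸ m) := Ideal.Quotient.field m
  have : Module.Finite k (C ⧸ m) := finite_of_finite_type_of_isJacobsonRing k (C ⧸ m)
  have : Algebra.IsIntegral k (C ⧸ m) := Algebra.IsIntegral.of_finite k (C ⧸ m)
  have hb : Function.Bijective (algebraMap k (C ⧸ m)) :=
    IsAlgClosed.algebraMap_bijective_of_isIntegral
  let φ : k ≃ₐ[k] (C ⧸ m) := AlgEquiv.ofBijective (Algebra.ofId k (C ⧸ m)) hb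
  refine ⟨WithConv.toConv ((φ.symm : (C ⧸ m) →ₐ[k] k).comp (Ideal.Quotient.mkₐ k m)), fun a => ?_⟩
  change φ.symm (Ideal.Quotient.mk m a) = 0 ↔ _
  rw [EmbeddingLike.map_eq_zero_iff, Ideal.Quotient.eq_zero_iff_mem]

lemma exists_point_of_ne_top [IsAlgClosed k] [Algebra.FiniteType k C] {I : Ideal C} (hI : I ≠ ⊤) :
    ∃ x : Points k C, ∀ a ∈ I, x a = 0 := by
  obtain ⟨m, hm, hIm⟩ := Ideal.exists_le_maximal I hI
  obtain ⟨x, hx⟩ := exists_point_ker_eq (k := k) m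
  exact ⟨x, fun a ha => (hx a).2 (hIm ha)⟩

lemma ideal_eq_top_of_forall_point [IsAlgClosed k] [Algebra.FiniteType k C] {I : Ideal C}
    (hI : ∀ x : Points k C, ∃ a ∈ I, x a ≠ 0) : I = ⊤ := by
  by_contra h
  obtain ⟨x, hx⟩ := exists_point_of_ne_top (k := k) h
  obtain ⟨a, ha, hxa⟩ := hI x
  exact hxa (hx a ha)

lemma exists_pow_eq_mul_of_zeros_subset [IsAlgClosed k] [Algebra.FiniteType k C] {a c : C}
    (h : ∀ x : Points k C, x c = 0 → x a = 0) : ∃ (n : ℕ) (d : C), a ^ n = d * c := by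
  have : IsJacobsonRing C := isJacobsonRing_of_finiteType (A := k)
  have : a ∈ (Ideal.span {c}).radical := by
    rw [Ideal.radical_eq_jacobson, Ideal.jacobson, Ideal.mem_sInf]
    rintro m ⟨hm, hmax⟩
    obtain ⟨x, hx⟩ := exists_point_ker_eq (k := k) m
    exact (hx a).1 (h x ((hx c).2 (hm (Ideal.mem_span_singleton_self c))))
  obtain ⟨n, hn⟩ := this
  obtain ⟨d, hd⟩ := Ideal.mem_span_singleton'.1 hn
  exact ⟨n, d, hd.symm⟩

lemma eq_of_forall_point [IsAlgClosed k] [Algebra.FiniteType k C] [IsReduced C] {a b : C}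
    (h : ∀ x : Points k C, x a = x b) : a = b := by
  obtain ⟨n, d, hd⟩ := exists_pow_eq_mul_of_zeros_subset (k := k) (a := a - b) (c := 0)
    (fun x _ => by rw [map_sub, h x, sub_self])
  rw [mul_zero] at hd
  exact sub_eq_zero.1 (eq_zero_of_pow_eq_zero hd)

lemma isOpen_ne_zero (s : C) : IsOpen {x : Points k C | x s ≠ 0} :=
  ⟨_, PrimeSpectrum.isOpen_basicOpen (a := s), by ext x; rfl⟩

lemma exists_ne_zero_subset {U : Set (Points k C)} (hU : IsOpen U) {x : Points k C} (hx : x ∈ U) :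
    ∃ s : C, x s ≠ 0 ∧ ∀ y : Points k C, y s ≠ 0 → y ∈ U := by
  obtain ⟨V, hV, rfl⟩ := hU
  obtain ⟨_, ⟨s, rfl⟩, hxs, hsV⟩ :=
    PrimeSpectrum.isTopologicalBasis_basic_opens.exists_subset_of_mem_open hx hV
  exact ⟨s, hxs, fun y hy => hsV (show y.toPrimeSpectrum ∈ _ from hy)⟩

/-- On a principal open subset of an affine variety, regular functions are fractions with a power
of the defining function as denominator. -/
lemma IsRegularOn.exists_eq_div_pow [IsAlgClosed k] [Algebra.FiniteType k C]
    {U : Set (Points k C)} {f : Points k C → k}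
    (hf : IsRegularOn U f) {c : C} (hc : ∀ y : Points k C, y c ≠ 0 → y ∈ U) :
    ∃ (n : ℕ) (a : C), ∀ y : Points k C, y c ^ n * f y * y c = y a := by
  -- The ideal of denominators of `f`. The factor `y c` makes the condition hold trivially where `c`
  -- vanishes, since nothing is known about `f` there.
  let J : Ideal C :=
    { carrier := {s | ∃ a : C, ∀ y : Points k C, y s * f y * y c = y a}
      add_mem' := by
        rintro s t ⟨a, ha⟩ ⟨b, hb⟩
        exact ⟨a + b, fun y => by rw [map_add, map_add, ← ha, ← hb]; ring⟩
      zero_mem' := ⟨0, fun y => by simp⟩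
      smul_mem' := by
        rintro r s ⟨a, ha⟩
        exact ⟨r * a, fun y => by rw [smul_eq_mul, map_mul, map_mul, ← ha]; ring⟩ }
  have hJ : c ∈ J.radical := by
    have : IsJacobsonRing C := isJacobsonRing_of_finiteType (A := k)
    rw [Ideal.radical_eq_jacobson, Ideal.jacobson, Ideal.mem_sInf]
    rintro m ⟨hm, hmax⟩
    obtain ⟨x, hx⟩ := exists_point_ker_eq (k := k) m
    by_contra hcm
    obtain ⟨a, s, hs, has⟩ := hf x (hc x fun h => hcm ((hx c).1 h))
    -- The square is needed: where `s` vanishes the fraction `a / s` says nothing about `f`, and `a`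
    -- need not vanish there, whereas `s * a` does.
    have hsJ : s * s ∈ J := by
      refine ⟨s * a * c, fun y => ?_⟩
      rcases eq_or_ne (y c) 0 with h | h
      · simp [h]
      rcases eq_or_ne (y s) 0 with h' | h'
      · simp [h']
      rw [has y (hc y h) h', map_mul, map_mul, map_mul]
      field_simp
    have := (hx _).2 (hm hsJ)
    rw [map_mul, mul_self_eq_zero] at this
    exact hs this
  obtain ⟨n, a, ha⟩ := hJ
  exact ⟨n, a, fun y => by rw [← ha, map_pow]⟩

lemma IsRegularOn.exists_eq_eval [IsAlgClosed k] [Algebra.FiniteType k C] {f : Points k C → k}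
    (hf : IsRegularOn Set.univ f) : ∃ a : C, ∀ y : Points k C, f y = y a := by
  obtain ⟨n, a, ha⟩ := hf.exists_eq_div_pow (c := 1) fun y _ => Set.mem_univ y
  exact ⟨a, fun y => by rw [← ha y]; simp⟩

lemma isRegularOn_eval (U : Set (Points k C)) (a : C) : IsRegularOn U fun y => y a :=
  fun x _ => ⟨a, 1, by simp, fun y _ _ => by simp⟩

/-- Evaluation of the second factor at a point. -/
def evalRight (V : Type u) [AddCommGroup V] [Module k V] (x : Points k C) : V ⊗[k] C →ₗ[k] V :=
  (TensorProduct.rid k V).toLinearMap ∘ₗ x.ofConv.toLinearMap.lTensor V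

section evalRight

variable {V W : Type u} [AddCommGroup V] [Module k V] [AddCommGroup W] [Module k W]

@[simp] lemma evalRight_tmul (x : Points k C) (v : V) (c : C) :
    evalRight V x (v ⊗ₜ c) = x c • v := by
  simp [evalRight]

lemma evalRight_rTensor (x : Points k C) (f : V →ₗ[k] W) (t : V ⊗[k] C) :
    evalRight W x (f.rTensor C t) = f (evalRight V x t) := by
  induction t with
  | zero => simp
  | tmul v c => simp
  | add s t hs ht => simp [hs, ht]

/-- In coordinates for a basis of `V` this is the statement that functions on a variety are
determined by their values. It reduces identities of coactions to identities of group actions. -/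
lemma eq_of_forall_evalRight [IsAlgClosed k] [Algebra.FiniteType k C] [IsReduced C]
    {s t : V ⊗[k] C} (h : ∀ x : Points k C, evalRight V x s = evalRight V x t) : s = t := by
  classical
  let b := Module.Basis.ofVectorSpace k V
  let e := TensorProduct.equivFinsuppOfBasisLeft (N := C) b
  apply e.injective
  ext i
  apply eq_of_forall_point (k := k)
  intro x
  have key : ∀ t : V ⊗[k] C, x (e t i) = b.coord i (evalRight V x t) := by
    intro t
    induction t with
    | zero => simp
    | tmul v c => simp [e, mul_comm]
    | add s t hs ht => simp only [map_add, Finsupp.add_apply, hs, ht]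
  rw [key, key, h]

lemma exists_eq_sum_tmul {s : V ⊗[k] C} :
    ∃ (n : ℕ) (v : Fin n → V) (c : Fin n → C), s = ∑ i, v i ⊗ₜ[k] c i := by
  induction s with
  | zero => exact ⟨0, Fin.elim0, Fin.elim0, by simp⟩
  | tmul v c => exact ⟨1, fun _ => v, fun _ => c, by simp⟩
  | add s t hs ht =>
    obtain ⟨n, v, c, rfl⟩ := hs
    obtain ⟨m, w, d, rfl⟩ := ht
    exact ⟨n + m, Fin.append v w, Fin.append c d, by simp [Fin.sum_univ_add]⟩

end evalRight

end Points

/-! ### Left translation of functions on the group -/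

section Translations

variable {k A : Type u} [Field k] [CommRing A] [HopfAlgebra k A]

lemma points_mul_apply (x y : Points k A) (a : A) :
    (x * y) a = x (evalRight A y (Coalgebra.comul a)) := by
  rw [AlgHom.convMul_apply]
  generalize (Coalgebra.comul a : A ⊗[k] A) = t
  induction t with
  | zero => simp
  | tmul v c => simp [mul_comm]
  | add s t hs ht => simp only [map_add, hs, ht]

lemma points_inv_apply (x : Points k A) (a : A) : x⁻¹ a = x (HopfAlgebra.antipode k a) := rfl

/-- Left translation of functions, `(L g a) (x) = a (g x)`. -/
def leftTranslation (g : Points k A) : A →ₐ[k] A :=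
  (Algebra.TensorProduct.lift ((Algebra.ofId k A).comp g.ofConv) (AlgHom.id k A)
    fun _ _ => Commute.all _ _).comp (Bialgebra.comulAlgHom k A)

@[simp] lemma apply_leftTranslation (g x : Points k A) (a : A) :
    x (leftTranslation g a) = (g * x) a := by
  rw [AlgHom.convMul_apply]
  change x (Algebra.TensorProduct.lift ((Algebra.ofId k A).comp g.ofConv) (AlgHom.id k A)
    (fun _ _ => Commute.all _ _) (Coalgebra.comul a)) = _
  generalize (Coalgebra.comul a : A ⊗[k] A) = t
  induction t with
  | zero => simp
  | tmul v c => simp [Algebra.ofId_apply]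
  | add s t hs ht => simp only [map_add, hs, ht]

end Translations

/-! ### Rational modules as polynomial group actions; local finiteness -/

namespace RationalAction

variable {k B : Type u} [Field k] [CommRing B] [HopfAlgebra k B]
variable {M N : Type u} [AddCommGroup M] [Module k M] [AddCommGroup N] [Module k N]

lemma act_apply (ρ : RationalAction k B M) (x : Points k B) (m : M) :
    ρ.act x m = evalRight M x (ρ.coact m) := rfl

lemma act_one (ρ : RationalAction k B M) (m : M) : ρ.act 1 m = m :=
  LinearMap.congr_fun ρ.counit_comp m

lemma act_mul (ρ : RationalAction k B M) (x y : Points k B) (m : M) :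
    ρ.act (x * y) m = ρ.act x (ρ.act y m) := by
  have h₁ : ∀ t : M ⊗[k] B, evalRight M (x * y) t =
      evalRight M x (evalRight _ y ((TensorProduct.assoc k M B B).symm
        (Coalgebra.comul.lTensor M t))) := by
    intro t
    induction t with
    | zero => simp
    | tmul v c =>
      rw [evalRight_tmul, points_mul_apply, LinearMap.lTensor_tmul]
      generalize (Coalgebra.comul c : B ⊗[k] B) = s
      induction s with
      | zero => simp
      | tmul a b => simp [mul_smul]
      | add s t hs ht => simp only [map_add, TensorProduct.tmul_add, add_smul, hs, ht]
    | add s t hs ht => simp only [map_add, hs, ht]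
  have h₂ := LinearMap.congr_fun ρ.coassoc m
  simp only [LinearMap.comp_apply, LinearEquiv.coe_coe] at h₂
  rw [act_apply, h₁, ← h₂, LinearEquiv.symm_apply_apply, evalRight_rTensor]
  rfl

lemma act_inv_act (ρ : RationalAction k B M) (x : Points k B) (m : M) :
    ρ.act x⁻¹ (ρ.act x m) = m := by
  rw [← act_mul, inv_mul_cancel, act_one]

lemma act_act_inv (ρ : RationalAction k B M) (x : Points k B) (m : M) :
    ρ.act x (ρ.act x⁻¹ m) = m := by
  rw [← act_mul, mul_inv_cancel, act_one]

/-- The element `∑ m₀ ⊗ S m₁`, i.e. the function `x ↦ x⁻¹ m`. -/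
def coactInv (ρ : RationalAction k B M) : M →ₗ[k] M ⊗[k] B :=
  (HopfAlgebra.antipode k (A := B)).lTensor M ∘ₗ ρ.coact

lemma evalRight_coactInv (ρ : RationalAction k B M) (x : Points k B) (m : M) :
    evalRight M x (ρ.coactInv m) = ρ.act x⁻¹ m := by
  rw [act_apply, coactInv, LinearMap.comp_apply]
  generalize ρ.coact m = t
  induction t with
  | zero => simp
  | tmul v c => simp [points_inv_apply]
  | add s t hs ht => simp only [map_add, hs, ht]

lemma apply_regular_act (x y : Points k B) (b : B) :
    y ((regular k B).act x b) = (y * x) b :=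
  (points_mul_apply y x b).symm

lemma regular_act_one (x : Points k B) : (regular k B).act x 1 = 1 := by
  change evalRight B x (Coalgebra.comul 1) = 1
  simp [Algebra.TensorProduct.one_def]

section IsAlgClosed

variable [IsAlgClosed k] [Algebra.FiniteType k B] [IsReduced B]

/-- A linear action of the group of points which is given by polynomial functions is rational. -/
def ofPoints (a : Points k B →* Module.End k M)
    (h : ∀ m, ∃ t : M ⊗[k] B, ∀ x, evalRight M x t = a x m) : RationalAction k B M where
  coact :=
    { toFun := fun m => (h m).choose
      map_add' := fun m n => eq_of_forall_evalRight fun x => by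
        rw [map_add, (h m).choose_spec, (h n).choose_spec, (h (m + n)).choose_spec, map_add]
      map_smul' := fun c m => eq_of_forall_evalRight fun x => by
        rw [RingHom.id_apply, map_smul, (h m).choose_spec, (h (c • m)).choose_spec, map_smul] }
  coassoc := by
    ext m
    have hm := (h m).choose_spec
    simp only [LinearMap.comp_apply, LinearEquiv.coe_coe, LinearMap.coe_mk, AddHom.coe_mk]
    rw [← LinearEquiv.eq_symm_apply]
    apply eq_of_forall_evalRight
    intro y
    apply eq_of_forall_evalRight
    intro x
    rw [evalRight_rTensor, hm]
    change evalRight M x (h (a y m)).choose = _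
    rw [(h (a y m)).choose_spec, ← Module.End.mul_apply, ← map_mul, ← hm]
    generalize (h m).choose = t
    induction t with
    | zero => simp
    | tmul v c =>
      rw [evalRight_tmul, points_mul_apply, LinearMap.lTensor_tmul]
      generalize (Coalgebra.comul c : B ⊗[k] B) = s
      induction s with
      | zero => simp
      | tmul a b => simp [mul_smul]
      | add s t hs ht => simp only [map_add, TensorProduct.tmul_add, add_smul, hs, ht]
    | add s t hs ht => simp only [map_add, hs, ht]
  counit_comp := by
    ext m
    change evalRight M 1 (h m).choose = m
    rw [(h m).choose_spec, map_one, Module.End.one_apply]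

@[simp] lemma ofPoints_act (a : Points k B →* Module.End k M)
    (h : ∀ m, ∃ t : M ⊗[k] B, ∀ x, evalRight M x t = a x m) (x : Points k B) (m : M) :
    (ofPoints a h).act x m = a x m :=
  (h m).choose_spec x

lemma coact_of_mem_invariants (ρ : RationalAction k B M) {m : M} (hm : m ∈ ρ.invariants) :
    ρ.coactInv m = m ⊗ₜ 1 :=
  eq_of_forall_evalRight fun x => by
    rw [evalRight_coactInv, evalRight_tmul, map_one, one_smul, hm]

end IsAlgClosed

/-- The smallest stable subspace containing `s`. -/
def stableSpan (ρ : RationalAction k B M) (s : Set M) : Submodule k M :=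
  Submodule.span k {n | ∃ x, ∃ m ∈ s, n = ρ.act x m}

lemma subset_stableSpan (ρ : RationalAction k B M) (s : Set M) : s ⊆ ρ.stableSpan s :=
  fun m hm => Submodule.subset_span ⟨1, m, hm, (ρ.act_one m).symm⟩

lemma act_mem_stableSpan (ρ : RationalAction k B M) (s : Set M) (x : Points k B) {m : M}
    (hm : m ∈ ρ.stableSpan s) : ρ.act x m ∈ ρ.stableSpan s := by
  induction hm using Submodule.span_induction with
  | mem n hn =>
    obtain ⟨y, m, hm, rfl⟩ := hn
    exact Submodule.subset_span ⟨x * y, m, hm, by rw [act_mul]⟩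
  | zero => simp
  | add m n _ _ hm hn => rw [map_add]; exact add_mem hm hn
  | smul c m _ hm => rw [map_smul]; exact Submodule.smul_mem _ c hm

/-- All translates of `m` are combinations of the finitely many `m₀` in one expression `∑ m₀ ⊗ m₁`
of the coaction. -/
lemma finiteDimensional_stableSpan (ρ : RationalAction k B M) {s : Set M} (hs : s.Finite) :
    FiniteDimensional k (ρ.stableSpan s) := by
  choose n v c hvc using fun m : M => exists_eq_sum_tmul (s := ρ.coact m)
  have hfin : (⋃ m ∈ s, Set.range (v m)).Finite := hs.biUnion fun m _ => Set.finite_range _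
  have := FiniteDimensional.span_of_finite k hfin
  refine Submodule.finiteDimensional_of_le (S₂ := Submodule.span k (⋃ m ∈ s, Set.range (v m)))
    (Submodule.span_le.2 ?_)
  rintro _ ⟨x, m, hm, rfl⟩
  rw [act_apply, hvc, map_sum]
  refine sum_mem fun i _ => ?_
  rw [evalRight_tmul]
  exact Submodule.smul_mem _ _ (Submodule.subset_span (Set.mem_biUnion hm ⟨i, rfl⟩))

end RationalAction

/-! ### Right translation by `H` on `k[G]` and its invariants -/

section CoordinateAction

variable {k A B : Type u} [Field k] [CommRing A] [HopfAlgebra k A] [CommRing B] [HopfAlgebra k B]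
variable (π : A →ₐc[k] B)

lemma apply_coordinateAction_act (x : Points k B) (y : Points k A) (a : A) :
    y ((coordinateAction π).act x a) = (y * inclusion π x) a := by
  rw [points_mul_apply]
  change y (evalRight A x ((π : A →ₗ[k] B).lTensor A (Coalgebra.comul a))) = _
  generalize (Coalgebra.comul a : A ⊗[k] A) = t
  induction t with
  | zero => simp
  | tmul v c => simp [inclusion]
  | add s t hs ht => simp only [map_add, hs, ht]

lemma inclusion_apply (x : Points k B) (a : A) : inclusion π x a = x (π a) := rfl

lemma map_coordinateAction_act [IsAlgClosed k] [Algebra.FiniteType k B] [IsReduced B]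
    (x : Points k B) (a : A) :
    π ((coordinateAction π).act x a) = (RationalAction.regular k B).act x (π a) :=
  eq_of_forall_point (k := k) fun y => by
    rw [RationalAction.apply_regular_act, ← inclusion_apply, apply_coordinateAction_act,
      ← map_mul, inclusion_apply]

variable [IsAlgClosed k] [Algebra.FiniteType k A] [IsReduced A]

lemma coordinateAction_act_mul (x : Points k B) (a b : A) :
    (coordinateAction π).act x (a * b) =
      (coordinateAction π).act x a * (coordinateAction π).act x b :=
  eq_of_forall_point (k := k) fun y => by simp only [apply_coordinateAction_act, map_mul]

lemma coordinateAction_act_one (x : Points k B) : (coordinateAction π).act x 1 = 1 :=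
  eq_of_forall_point (k := k) fun y => by simp only [apply_coordinateAction_act, map_one]

lemma coordinateAction_act_leftTranslation (x : Points k B) (g : Points k A) (a : A) :
    (coordinateAction π).act x (leftTranslation g a) =
      leftTranslation g ((coordinateAction π).act x a) :=
  eq_of_forall_point (k := k) fun y => by
    rw [apply_coordinateAction_act, apply_leftTranslation, apply_leftTranslation,
      apply_coordinateAction_act, mul_assoc]

lemma mem_invariants_coordinateAction {a : A} :
    a ∈ (coordinateAction π).invariants ↔
      ∀ (y : Points k A) (x : Points k B), (y * inclusion π x) a = y a := by
  constructor
  · intro h y x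
    rw [← apply_coordinateAction_act, h]
  · intro h x
    exact eq_of_forall_point (k := k) fun y => by rw [apply_coordinateAction_act, h]

/-- The algebra of functions on `G` which are invariant under `H`. -/
def invariantSubalgebra : Subalgebra k A where
  carrier := {a | a ∈ (coordinateAction π).invariants}
  mul_mem' ha hb x := by rw [coordinateAction_act_mul, ha x, hb x]
  add_mem' ha hb := (coordinateAction π).invariants.add_mem ha hb
  algebraMap_mem' c x := by
    rw [Algebra.algebraMap_eq_smul_one, map_smul, coordinateAction_act_one]

end CoordinateAction

/-! ### Averaging operators, and exactness from local integrals -/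

section Averaging

variable {k A B : Type u} [Field k] [CommRing A] [HopfAlgebra k A] [CommRing B] [HopfAlgebra k B]
variable {π : A →ₐc[k] B}

/-- The linear map `v ⊗ b ↦ σ b • v`. -/
def smulVia (σ : B →ₗ[k] A) (M : Type u) [AddCommGroup M] [Module k M] [Module A M]
    [IsScalarTower k A M] : M ⊗[k] B →ₗ[k] M :=
  TensorProduct.lift ((Algebra.lsmul k k M).toLinearMap ∘ₗ σ).flip

@[simp] lemma smulVia_tmul (σ : B →ₗ[k] A) {M : Type u} [AddCommGroup M] [Module k M] [Module A M]
    [IsScalarTower k A M] (m : M) (b : B) : smulVia σ M (m ⊗ₜ b) = σ b • m := rfl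

namespace EquivariantModule

/-- The operator `m ↦ ∑ σ (S m₁) m₀`; it is a projection onto the invariants if `σ` is a total
integral. -/
def average (M : EquivariantModule π) (σ : B →ₗ[k] A) : M.carrier →ₗ[k] M.carrier :=
  smulVia σ M.carrier ∘ₗ M.action.coactInv

variable [IsAlgClosed k] [Algebra.FiniteType k B] [IsReduced B]

/-- At a point `y` both sides are `y⁻¹ m`, because `x ((y x)⁻¹ m) = y⁻¹ m`. -/
lemma map_act_coactInv (M : EquivariantModule π) (x : Points k B) (m : M.carrier) :
    TensorProduct.map (M.action.act x) ((RationalAction.regular k B).act x)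
      (M.action.coactInv m) = M.action.coactInv m := by
  apply eq_of_forall_evalRight
  intro y
  have h : ∀ t : M.carrier ⊗[k] B,
      evalRight _ y (TensorProduct.map (M.action.act x) ((RationalAction.regular k B).act x) t) =
        M.action.act x (evalRight _ (y * x) t) := by
    intro t
    induction t with
    | zero => simp
    | tmul v c => simp [RationalAction.apply_regular_act]
    | add s t hs ht => simp only [map_add, hs, ht]
  rw [h, RationalAction.evalRight_coactInv, RationalAction.evalRight_coactInv, mul_inv_rev,
    RationalAction.act_mul, RationalAction.act_act_inv]

/-- Acting by `x` on the average amounts to acting diagonally on `∑ m₀ ⊗ S m₁`, which is fixed.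
Equivariance of `σ` enters only at the `c i`, which is why local integrals suffice. -/
lemma average_mem_invariants (M : EquivariantModule π) {σ : B →ₗ[k] A} {ι : Type*} [Fintype ι]
    {m : M.carrier} {v : ι → M.carrier} {c : ι → B} (h : M.action.coactInv m = ∑ i, v i ⊗ₜ c i)
    (hσ : ∀ x i, σ ((RationalAction.regular k B).act x (c i)) =
      (coordinateAction π).act x (σ (c i))) :
    M.average σ m ∈ M.invariants := by
  intro x
  have h₁ : M.average σ m = smulVia σ _ (TensorProduct.map (M.action.act x)
      ((RationalAction.regular k B).act x) (M.action.coactInv m)) := by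
    rw [map_act_coactInv]; rfl
  conv_rhs => rw [h₁]
  change M.action.act x (smulVia σ _ (M.action.coactInv m)) = _
  simp [h, M.act_smul, hσ]

lemma average_of_mem_invariants (M : EquivariantModule π) {σ : B →ₗ[k] A} (hσ : σ 1 = 1)
    {m : M.carrier} (hm : m ∈ M.invariants) : M.average σ m = m := by
  change smulVia σ _ (M.action.coactInv m) = m
  rw [RationalAction.coact_of_mem_invariants _ hm, smulVia_tmul, hσ, one_smul]

lemma Hom.map_average {M N : EquivariantModule π} (f : M.Hom N) (σ : B →ₗ[k] A) (m : M.carrier) :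
    f.toLinearMap (M.average σ m) = N.average σ (f.toLinearMap m) := by
  have h : N.action.coactInv (f.toLinearMap m) =
      (f.toLinearMap.restrictScalars k).rTensor B (M.action.coactInv m) := by
    apply eq_of_forall_evalRight
    intro x
    rw [RationalAction.evalRight_coactInv, evalRight_rTensor, RationalAction.evalRight_coactInv]
    exact (f.map_act x⁻¹ m).symm
  change f.toLinearMap (smulVia σ _ (M.action.coactInv m)) = smulVia σ _ (N.action.coactInv _)
  rw [h]
  generalize M.action.coactInv m = t
  induction t with
  | zero => simp
  | tmul v c => simp
  | add s t hs ht => simp only [map_add, hs, ht]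

end EquivariantModule

/-- A weak form of the existence of a total integral: there are linear maps `σ` with `σ 1 = 1`
which are equivariant on any given finite set. -/
def HasLocalIntegrals (π : A →ₐc[k] B) : Prop :=
  ∀ s : Set B, s.Finite → ∃ σ : B →ₗ[k] A, σ 1 = 1 ∧ ∀ b ∈ s, ∀ x,
    σ ((RationalAction.regular k B).act x b) = (coordinateAction π).act x (σ b)

lemma IsTotalIntegral.hasLocalIntegrals {σ : B →ₗ[k] A} (hσ : IsTotalIntegral π σ) :
    HasLocalIntegrals π :=
  fun _ _ => ⟨σ, hσ.map_one, fun b _ x => hσ.map_act x b⟩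

/-- Only surjectivity on invariants needs integrals: averaging an arbitrary preimage of an invariant
element gives an invariant preimage, by naturality. -/
lemma HasLocalIntegrals.isExactSubgroup [IsAlgClosed k] [Algebra.FiniteType k B] [IsReduced B]
    (h : HasLocalIntegrals π) : IsExactSubgroup π := by
  intro P Q R f g hf hfg hg
  refine ⟨fun m n hmn => Subtype.ext (hf (congrArg Subtype.val hmn)), fun q => ⟨fun hq => ?_, ?_⟩,
    fun r => ?_⟩
  · have hq' : g.toLinearMap q = 0 := congrArg Subtype.val hq
    obtain ⟨p, hp⟩ := (hfg q).1 hq'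
    refine ⟨⟨p, fun x => hf ?_⟩, Subtype.ext hp⟩
    rw [f.map_act, hp, q.2 x]
  · rintro ⟨p, rfl⟩
    exact Subtype.ext ((hfg _).2 ⟨p, rfl⟩)
  · obtain ⟨q, hq⟩ := hg r
    obtain ⟨n, v, c, hvc⟩ := exists_eq_sum_tmul (s := Q.action.coactInv q)
    obtain ⟨σ, hσ₁, hσ⟩ := h (Set.range c) (Set.finite_range c)
    refine ⟨⟨Q.average σ q, Q.average_mem_invariants hvc fun x i => hσ _ ⟨i, rfl⟩ x⟩,
      Subtype.ext ?_⟩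
    change g.toLinearMap (Q.average σ q) = r
    rw [g.map_average, hq, R.average_of_mem_invariants hσ₁ r.2]

end Averaging

/-! ### Modules of linear maps and extension of equivariant maps -/

section ExtensionOfIntegrals

variable {k A B : Type u} [Field k] [CommRing A] [HopfAlgebra k A] [CommRing B] [HopfAlgebra k B]
variable {π : A →ₐc[k] B}

/-- `N` is a subspace of `k[H]` stable under right translations. -/
def IsStable (N : Submodule k B) : Prop :=
  ∀ x, ∀ b ∈ N, (RationalAction.regular k B).act x b ∈ N

lemma IsStable.inf {N N' : Submodule k B} (h : IsStable N) (h' : IsStable N') :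
    IsStable (N ⊓ N') :=
  fun x b hb => ⟨h x b hb.1, h' x b hb.2⟩

/-- The action `(x φ) (n) = x (φ (x⁻¹ n))` on linear maps. -/
def homAct (π : A →ₐc[k] B) {N : Submodule k B} (hN : IsStable N) :
    Points k B →* Module.End k (N →ₗ[k] A) where
  toFun x :=
    { toFun := fun φ => (coordinateAction π).act x ∘ₗ φ ∘ₗ
        ((RationalAction.regular k B).act x⁻¹).restrict (hN x⁻¹)
      map_add' := fun φ ψ => by ext; simp
      map_smul' := fun c φ => by ext; simp }
  map_one' := by
    ext φ n
    change (coordinateAction π).act 1 (φ ⟨(RationalAction.regular k B).act 1⁻¹ n, _⟩) = φ n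
    rw [RationalAction.act_one]
    congr
    rw [inv_one, RationalAction.act_one]
  map_mul' x y := by
    ext φ n
    change (coordinateAction π).act (x * y) (φ ⟨(RationalAction.regular k B).act (x * y)⁻¹ n, _⟩) =
      (coordinateAction π).act x ((coordinateAction π).act y
        (φ ⟨(RationalAction.regular k B).act y⁻¹ ((RationalAction.regular k B).act x⁻¹ n), _⟩))
    rw [RationalAction.act_mul]
    congr 3
    exact Subtype.ext (by rw [mul_inv_rev]; exact RationalAction.act_mul _ _ _ _)

lemma homAct_apply {N : Submodule k B} (hN : IsStable N) (x : Points k B) (φ : N →ₗ[k] A) (n : N) :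
    homAct π hN x φ n = (coordinateAction π).act x
      (φ ⟨(RationalAction.regular k B).act x⁻¹ n, hN x⁻¹ n n.2⟩) := rfl

/-- Restriction of linear maps to a smaller subspace. -/
def restrictLinearMap {N N' : Submodule k B} (h : N ≤ N') : (N' →ₗ[k] A) →ₗ[A] (N →ₗ[k] A) where
  toFun φ := φ ∘ₗ Submodule.inclusion h
  map_add' _ _ := rfl
  map_smul' _ _ := rfl

lemma restrictLinearMap_homAct {N N' : Submodule k B} (hN : IsStable N) (hN' : IsStable N')
    (h : N ≤ N') (x : Points k B) (φ : N' →ₗ[k] A) :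
    restrictLinearMap h (homAct π hN' x φ) = homAct π hN x (restrictLinearMap h φ) := rfl

/-- For each `n` the function `x ↦ x (φ (x⁻¹ n))` is polynomial; a finite basis of `N` assembles
these functions into one tensor, which makes the action on linear maps rational. -/
lemma exists_evalRight_eq_homAct {N : Submodule k B} [FiniteDimensional k N] (hN : IsStable N)
    (φ : N →ₗ[k] A) :
    ∃ t : (N →ₗ[k] A) ⊗[k] B, ∀ x, evalRight _ x t = homAct π hN x φ := by
  -- The components `v i` of the coaction below need not lie in `N`, so `φ` is first extended
  -- linearly to `k[H]`.
  obtain ⟨φ', hφ'⟩ := LinearMap.exists_extend φ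
  have h₁ : ∀ n : N, ∃ t : A ⊗[k] B, ∀ x, evalRight _ x t = homAct π hN x φ n := by
    intro n
    obtain ⟨m, v, c, hvc⟩ :=
      exists_eq_sum_tmul (s := (RationalAction.regular k B).coactInv (n : B))
    refine ⟨∑ i, (1 ⊗ₜ c i) * (coordinateAction π).coact (φ' (v i)), fun x => ?_⟩
    have hmul : ∀ (b : B) (t : A ⊗[k] B), evalRight A x ((1 ⊗ₜ b) * t) = x b • evalRight A x t := by
      intro b t
      induction t with
      | zero => simp
      | tmul v c => simp [mul_smul]
      | add s t hs ht => simp only [mul_add, map_add, smul_add, hs, ht]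
    have hn := (RationalAction.regular k B).evalRight_coactInv x (n : B)
    rw [hvc] at hn
    have hφ : φ ⟨(RationalAction.regular k B).act x⁻¹ n, hN x⁻¹ n n.2⟩ =
        φ' ((RationalAction.regular k B).act x⁻¹ n) :=
      (LinearMap.congr_fun hφ' ⟨(RationalAction.regular k B).act x⁻¹ n, hN x⁻¹ n n.2⟩).symm
    rw [homAct_apply, hφ, ← hn]
    simp only [map_sum, hmul, evalRight_tmul, map_smul]
    rfl
  choose t ht using h₁
  let b := Module.finBasis k N
  refine ⟨∑ j, (LinearMap.smulRightₗ (b.coord j)).rTensor B (t (b j)), fun x => ?_⟩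
  apply b.ext
  intro j
  simp only [map_sum, evalRight_rTensor, ht, LinearMap.sum_apply, LinearMap.smulRightₗ_apply]
  rw [Finset.sum_eq_single j]
  · simp
  · intro i _ hij
    simp [hij.symm]
  · simp

variable [IsAlgClosed k] [Algebra.FiniteType k B] [IsReduced B]

/-- The restriction of a rational action to a stable subspace. -/
def RationalAction.ofStable {M : Type u} [AddCommGroup M] [Module k M] (ρ : RationalAction k B M)
    (P : Submodule k M) (hP : ∀ x, ∀ m ∈ P, ρ.act x m ∈ P) : RationalAction k B P :=
  RationalAction.ofPoints
    { toFun := fun x => (ρ.act x).restrict (hP x)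
      map_one' := by
        ext m
        exact ρ.act_one m
      map_mul' := fun x y => by
        ext m
        exact ρ.act_mul x y m }
    (fun m => by
      -- A merely linear retraction onto `P` is enough: it fixes every `x m` with `m ∈ P`.
      obtain ⟨q, hq⟩ := LinearMap.exists_leftInverse_of_injective P.subtype P.ker_subtype
      refine ⟨q.rTensor B (ρ.coact m), fun x => ?_⟩
      rw [evalRight_rTensor]
      exact LinearMap.congr_fun hq ⟨ρ.act x m, hP x m m.2⟩)

lemma RationalAction.coe_ofStable_act {M : Type u} [AddCommGroup M] [Module k M]
    (ρ : RationalAction k B M) (P : Submodule k M) (hP : ∀ x, ∀ m ∈ P, ρ.act x m ∈ P)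
    (x : Points k B) (m : P) : ((ρ.ofStable P hP).act x m : M) = ρ.act x m :=
  congrArg Subtype.val (RationalAction.ofPoints_act _ _ x m)

/-- A stable `k[G]`-submodule of a `(k[G], H)`-module. -/
def EquivariantModule.ofSubmodule (M : EquivariantModule π) (P : Submodule A M.carrier)
    (hP : ∀ x, ∀ m ∈ P, M.action.act x m ∈ P) : EquivariantModule π where
  carrier := P
  moduleBase := (P.restrictScalars k).module
  isScalarTower := ⟨fun a b m => Subtype.ext (smul_assoc a b (m : M.carrier))⟩
  action := M.action.ofStable (P.restrictScalars k) hP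
  act_smul x r m := Subtype.ext <| by
    refine (RationalAction.coe_ofStable_act _ _ _ _ _).trans ((M.act_smul x r m).trans ?_)
    exact congrArg _ (RationalAction.coe_ofStable_act _ (P.restrictScalars k) hP x m).symm

/-- The inclusion of a stable `k[G]`-submodule. -/
def EquivariantModule.subtype (M : EquivariantModule π) (P : Submodule A M.carrier)
    (hP : ∀ x, ∀ m ∈ P, M.action.act x m ∈ P) : (M.ofSubmodule P hP).Hom M where
  toLinearMap := P.subtype
  map_act x m := RationalAction.coe_ofStable_act _ (P.restrictScalars k) hP x m

variable [Algebra.FiniteType k A] [IsReduced A]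

/-- The `(k[G], H)`-module of linear maps from a finite dimensional rational module to `k[G]`. -/
def homModule (π : A →ₐc[k] B) {N : Submodule k B} [FiniteDimensional k N] (hN : IsStable N) :
    EquivariantModule π where
  carrier := N →ₗ[k] A
  action := RationalAction.ofPoints (homAct π hN) (exists_evalRight_eq_homAct hN)
  act_smul x r φ := by
    ext n
    simp only [RationalAction.ofPoints_act, homAct_apply, LinearMap.smul_apply, smul_eq_mul,
      coordinateAction_act_mul]

lemma homModule_act {N : Submodule k B} [FiniteDimensional k N] (hN : IsStable N)
    (x : Points k B) (φ : N →ₗ[k] A) :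
    (homModule π hN).action.act x φ = homAct π hN x φ :=
  RationalAction.ofPoints_act _ _ x φ

/-- Restriction of linear maps, as a morphism of `(k[G], H)`-modules. -/
def restrictHom (π : A →ₐc[k] B) {N N' : Submodule k B} [FiniteDimensional k N]
    [FiniteDimensional k N'] (hN : IsStable N) (hN' : IsStable N') (h : N ≤ N') :
    (homModule π hN').Hom (homModule π hN) where
  toLinearMap := restrictLinearMap h
  map_act x φ :=
    (congrArg (restrictLinearMap h) (homModule_act hN' x φ)).trans
      ((restrictLinearMap_homAct hN hN' h x φ).trans (homModule_act hN x _).symm)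

/-- Invariant elements of `Hom(N, k[G])` are the equivariant maps. Exactness is applied to the
restriction map, surjective since linear maps extend, and to its kernel. -/
lemma IsExactSubgroup.exists_extend (hex : IsExactSubgroup π) {N N' : Submodule k B}
    [FiniteDimensional k N] [FiniteDimensional k N'] (hN : IsStable N) (hN' : IsStable N')
    (h : N ≤ N') (φ : N →ₗ[k] A)
    (hφ : ∀ x (n : N), φ ⟨_, hN x n n.2⟩ = (coordinateAction π).act x (φ n)) :
    ∃ ψ : N' →ₗ[k] A, (∀ x (n : N'), ψ ⟨_, hN' x n n.2⟩ = (coordinateAction π).act x (ψ n)) ∧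
      ∀ n, ψ (Submodule.inclusion h n) = φ n := by
  have hinv : ∀ {N : Submodule k B} [FiniteDimensional k N] (hN : IsStable N) (φ : N →ₗ[k] A),
      φ ∈ (homModule π hN).invariants ↔
        ∀ x (n : N), φ ⟨_, hN x n n.2⟩ = (coordinateAction π).act x (φ n) := by
    intro N _ hN φ
    constructor
    · intro H x n
      have := LinearMap.congr_fun ((homModule_act hN x φ).symm.trans (H x)) ⟨_, hN x n n.2⟩
      rw [homAct_apply] at this
      rw [← this]
      congr
      exact RationalAction.act_inv_act _ x (n : B)
    · intro H x
      refine (homModule_act hN x φ).trans ?_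
      refine LinearMap.ext fun n => ?_
      rw [homAct_apply, H, RationalAction.act_act_inv]
  let g := restrictHom π hN hN' h
  have hker : ∀ x, ∀ m ∈ LinearMap.ker g.toLinearMap,
      (homModule π hN').action.act x m ∈ LinearMap.ker g.toLinearMap := by
    intro x m hm
    rw [LinearMap.mem_ker] at hm ⊢
    rw [g.map_act, hm, map_zero]
  obtain ⟨-, -, hs⟩ := hex _ _ _ ((homModule π hN').subtype _ hker) g Subtype.val_injective
    (fun y => ⟨fun hy => ⟨⟨y, hy⟩, rfl⟩, by rintro ⟨z, rfl⟩; exact z.2⟩) (fun (ψ : N →ₗ[k] A) => by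
      obtain ⟨χ, hχ⟩ := LinearMap.exists_extend ψ
      exact ⟨χ ∘ₗ N'.subtype, hχ⟩)
  obtain ⟨ψ, hψ⟩ := hs ⟨φ, (hinv hN φ).2 hφ⟩
  exact ⟨ψ.1, (hinv hN' ψ.1).1 ψ.2, LinearMap.congr_fun (congrArg Subtype.val hψ)⟩

end ExtensionOfIntegrals

/-! ### Exactness gives a total integral -/

section TotalIntegrals

variable {k A B : Type u} [Field k] [CommRing A] [HopfAlgebra k A] [CommRing B] [HopfAlgebra k B]
variable {π : A →ₐc[k] B}

/-- A partially defined linear map `k[H] → k[G]` is equivariant. -/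
def IsPartialIntegral (π : A →ₐc[k] B) (f : B →ₗ.[k] A) : Prop :=
  ∀ x (b : f.domain), ∃ h : (RationalAction.regular k B).act x b ∈ f.domain,
    f ⟨_, h⟩ = (coordinateAction π).act x (f b)

lemma exists_isPartialIntegral_upperBound {c : Set (B →ₗ.[k] A)}
    (hc : ∀ f ∈ c, IsPartialIntegral π f) (hchain : IsChain (· ≤ ·) c) (hne : c.Nonempty) :
    ∃ g, IsPartialIntegral π g ∧ ∀ f ∈ c, f ≤ g := by
  refine ⟨LinearPMap.sSup c hchain.directedOn, fun x b => ?_,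
    fun f hf => LinearPMap.le_sSup hchain.directedOn hf⟩
  obtain ⟨f, hf, hb⟩ := (LinearPMap.mem_domain_sSup_iff hne hchain.directedOn).1 b.2
  obtain ⟨h, hx⟩ := hc f hf x ⟨b, hb⟩
  refine ⟨(LinearPMap.le_sSup hchain.directedOn hf).1 h, ?_⟩
  have h₁ := LinearPMap.sSup_apply hchain.directedOn hf ⟨_, h⟩
  have h₂ := LinearPMap.sSup_apply hchain.directedOn hf ⟨b, hb⟩
  rw [h₁, hx, ← h₂]

lemma IsPartialIntegral.sup {f g : B →ₗ.[k] A} (hf : IsPartialIntegral π f)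
    (hg : IsPartialIntegral π g)
    (h : ∀ (x : f.domain) (y : g.domain), (x : B) = y → f x = g y) :
    IsPartialIntegral π (f.sup g h) := by
  intro x b
  obtain ⟨y, hy, z, hz, hyz⟩ := Submodule.mem_sup.1 b.2
  obtain ⟨hfy, ey⟩ := hf x ⟨y, hy⟩
  obtain ⟨hgz, ez⟩ := hg x ⟨z, hz⟩
  have hb : (RationalAction.regular k B).act x b ∈ f.domain ⊔ g.domain := by
    rw [← hyz, map_add]
    exact Submodule.add_mem_sup hfy hgz
  refine ⟨hb, ?_⟩
  refine (LinearPMap.sup_apply h ⟨_, hfy⟩ ⟨_, hgz⟩ ⟨_, hb⟩ (by simp [← hyz])).trans ?_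
  rw [ey, ez, ← map_add]
  exact congrArg _ (LinearPMap.sup_apply h ⟨y, hy⟩ ⟨z, hz⟩ b hyz).symm

variable [IsAlgClosed k] [Algebra.FiniteType k A] [IsReduced A]

/-- The linear map `c • 1 ↦ c • 1`, defined on the constant functions. -/
def constantIntegral (k A B : Type u) [Field k] [CommRing A] [HopfAlgebra k A] [CommRing B]
    [HopfAlgebra k B] [Nontrivial B] : B →ₗ.[k] A :=
  LinearPMap.mkSpanSingleton (1 : B) (1 : A) one_ne_zero

lemma isPartialIntegral_constantIntegral [Nontrivial B] :
    IsPartialIntegral π (constantIntegral k A B) := by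
  rintro x ⟨b, hb⟩
  obtain ⟨c, rfl⟩ := Submodule.mem_span_singleton.1 hb
  have h : (RationalAction.regular k B).act x (c • 1) = c • 1 := by
    rw [map_smul, RationalAction.regular_act_one]
  have hmem : (RationalAction.regular k B).act x (c • 1) ∈ (constantIntegral k A B).domain := by
    rw [h]; exact hb
  refine ⟨hmem, ?_⟩
  have h₁ : (⟨_, hmem⟩ : (constantIntegral k A B).domain) = ⟨c • 1, hb⟩ := Subtype.ext h
  have h₂ : constantIntegral k A B ⟨c • 1, hb⟩ = c • 1 :=
    LinearPMap.mkSpanSingleton'_apply (σ := RingHom.id k) 1 1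
      (fun c hc => by rw [(smul_eq_zero.1 hc).resolve_right one_ne_zero]; simp) c hb
  rw [h₁, h₂, map_smul, coordinateAction_act_one]

variable [Algebra.FiniteType k B] [IsReduced B]

/-- A maximal partial integral above `1 ↦ 1` is defined everywhere: otherwise its restriction to the
part of its domain inside a finite dimensional stable subspace around a new `b` extends to that
subspace, and the two maps glue. -/
lemma IsExactSubgroup.exists_isTotalIntegral (hex : IsExactSubgroup π) :
    ∃ σ : B →ₗ[k] A, IsTotalIntegral π σ := by
  have : Nontrivial B := (Bialgebra.counitAlgHom k B).toRingHom.domain_nontrivial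
  obtain ⟨f, hf₁, hf⟩ := zorn_le_nonempty₀ {f : B →ₗ.[k] A | IsPartialIntegral π f}
    (fun c hc hchain y hy => exists_isPartialIntegral_upperBound hc hchain ⟨y, hy⟩)
    _ isPartialIntegral_constantIntegral
  have hfi : IsPartialIntegral π f := hf.prop
  have htop : f.domain = ⊤ := by
    rw [eq_top_iff]
    intro b _
    let ρ := RationalAction.regular k B
    have hM : IsStable (ρ.stableSpan {b}) := fun x m hm => ρ.act_mem_stableSpan {b} x hm
    have hN : IsStable (f.domain ⊓ ρ.stableSpan {b}) :=
      IsStable.inf (fun x m hm => (hfi x ⟨m, hm⟩).1) hM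
    have := ρ.finiteDimensional_stableSpan (Set.finite_singleton b)
    have := Submodule.finiteDimensional_of_le
      (inf_le_right : f.domain ⊓ ρ.stableSpan {b} ≤ ρ.stableSpan {b})
    obtain ⟨ψ, hψ, hψf⟩ := hex.exists_extend hN hM inf_le_right
      (f.toFun ∘ₗ Submodule.inclusion inf_le_left) (fun x n => by
        obtain ⟨h, hx⟩ := hfi x ⟨n, n.2.1⟩
        exact hx)
    have hagree : ∀ (x : f.domain) (y : (⟨ρ.stableSpan {b}, ψ⟩ : B →ₗ.[k] A).domain),
        (x : B) = y → f x = (⟨ρ.stableSpan {b}, ψ⟩ : B →ₗ.[k] A) y := by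
      rintro ⟨x, hx⟩ ⟨y, hy⟩ rfl
      exact (hψf ⟨x, hx, hy⟩).symm
    have hg : IsPartialIntegral π (⟨ρ.stableSpan {b}, ψ⟩ : B →ₗ.[k] A) :=
      fun x n => ⟨hM x n n.2, hψ x n⟩
    have hle := hf.le_of_ge (hfi.sup hg hagree)
      (LinearPMap.left_le_sup _ _ _)
    exact hle.1 (Submodule.mem_sup_right (ρ.subset_stableSpan {b} rfl))
  let σ : B →ₗ[k] A := f.toFun ∘ₗ LinearMap.codRestrict f.domain LinearMap.id (by simp [htop])
  have hσ : ∀ b (hb : b ∈ f.domain), σ b = f ⟨b, hb⟩ := fun b hb => rfl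
  refine ⟨σ, fun x b => ?_, ?_⟩
  · obtain ⟨h, hx⟩ := hfi x ⟨b, htop ▸ Submodule.mem_top⟩
    exact hx
  · have h1 : (1 : B) ∈ (constantIntegral k A B).domain := Submodule.mem_span_singleton_self 1
    rw [hσ 1 (hf₁.1 h1), ← hf₁.2 (x := ⟨1, h1⟩) rfl]
    exact LinearPMap.mkSpanSingleton_apply k k one_ne_zero 1

end TotalIntegrals

/-! ### Determinants of translates and semi-equivariant maps -/

section Determinants

variable {k A B : Type u} [Field k] [CommRing A] [HopfAlgebra k A] [CommRing B] [HopfAlgebra k B]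
/-- The determinant of the left translates of `a` and of the functions `w i`, as a linear function
of `a`. -/
def translatesDet {ι : Type*} [Fintype ι] [DecidableEq ι] (w : ι → A)
    (g : Unit ⊕ ι → Points k A) : A →ₗ[k] A :=
  (Matrix.detRowAlternating.toMultilinearMap.toLinearMap
    (fun i j => leftTranslation (g j) (Sum.elim (fun _ => 0) w i)) (Sum.inl ())).restrictScalars k
    ∘ₗ LinearMap.pi fun j => (leftTranslation (g j)).toLinearMap

lemma translatesDet_apply {ι : Type*} [Fintype ι] [DecidableEq ι] (w : ι → A)
    (g : Unit ⊕ ι → Points k A) (a : A) : translatesDet w g a =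
      (Matrix.of fun i j => leftTranslation (g j) (Sum.elim (fun _ => a) w i)).det := by
  change Matrix.det (Function.update _ _ _) = _
  congr 1
  ext i j
  rcases i with ⟨⟩ | i <;> simp

variable [IsAlgClosed k] [Algebra.FiniteType k A] [IsReduced A]

/-- The vectors `(x (a i))ᵢ` span `k^ι`, since a linear form vanishing on all of them would be a
linear relation between the `a i`; a basis is then picked among them. -/
lemma exists_points_det_ne_zero {ι : Type*} [Fintype ι] [DecidableEq ι] {a : ι → A}
    (ha : LinearIndependent k a) :
    ∃ g : ι → Points k A, (Matrix.of fun i j => g i (a j)).det ≠ 0 := by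
  let v : Points k A → ι → k := fun x i => x (a i)
  have hspan : Submodule.span k (Set.range v) = ⊤ := by
    by_contra h
    obtain ⟨f, hf, hle⟩ := Submodule.exists_le_ker_of_lt_top _ (lt_top_iff_ne_top.2 h)
    apply hf
    have hsum : ∑ i, f (Pi.single i 1) • a i = 0 := by
      apply eq_of_forall_point (k := k)
      intro x
      have hx : f (v x) = 0 := hle (Submodule.subset_span ⟨x, rfl⟩)
      rw [LinearMap.pi_apply_eq_sum_univ] at hx
      simp only [map_sum, map_smul, smul_eq_mul, map_zero]
      rw [← hx]
      refine Finset.sum_congr rfl fun i _ => ?_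
      rw [smul_eq_mul, mul_comm]
      congr 2
      ext j
      simp [Pi.single_apply, eq_comm]
    apply LinearMap.pi_ext'
    intro i
    ext
    simpa using Fintype.linearIndependent_iff.1 ha _ hsum i
  obtain ⟨b, hb, hbspan, hbli⟩ := exists_linearIndependent k (Set.range v)
  let B' : Module.Basis b k (ι → k) := Module.Basis.mk hbli (by
    rw [Subtype.range_coe, hbspan, hspan])
  let e : ι ≃ b := (Pi.basisFun k ι).indexEquiv B'
  choose g hg using fun i => hb (e i).2
  refine ⟨g, ?_⟩
  have hli : LinearIndependent k (Matrix.of fun i j => g i (a j)).row := by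
    have : (Matrix.of fun i j => g i (a j)).row = (fun y : b => (y : ι → k)) ∘ e := by
      ext i j
      exact congrFun (hg i) j
    rw [this]
    exact hbli.comp e e.injective
  exact ((Matrix.isUnit_iff_isUnit_det _).1
    (Matrix.linearIndependent_rows_iff_isUnit.1 hli)).ne_zero

variable (π : A →ₐc[k] B)

/-- Right translation of functions as an algebra homomorphism. -/
def rightTranslation (x : Points k B) : A →ₐ[k] A :=
  AlgHom.ofLinearMap ((coordinateAction π).act x) (coordinateAction_act_one π x)
    (coordinateAction_act_mul π x)

/-- Right translations commute with left translations, so `x` acts row by row: the row of `a`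
becomes that of `x · a`, and the rows of the `w i` are mixed by `D`, which contributes the factor
`D.det`. -/
lemma act_translatesDet {ι : Type*} [Fintype ι] [DecidableEq ι] (w : ι → A)
    (g : Unit ⊕ ι → Points k A) (x : Points k B) (D : Matrix ι ι k)
    (hD : ∀ i, (coordinateAction π).act x (w i) = ∑ l, D i l • w l) (a : A) :
    (coordinateAction π).act x (translatesDet w g a) =
      D.det • translatesDet w g ((coordinateAction π).act x a) := by
  let E : Matrix (Unit ⊕ ι) (Unit ⊕ ι) A :=
    Matrix.fromBlocks 1 0 0 (D.map (algebraMap k A))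
  have hE : E.det = algebraMap k A D.det := by
    rw [Matrix.det_fromBlocks_zero₂₁, Matrix.det_one, one_mul]
    exact ((algebraMap k A).map_det D).symm
  have h : (Matrix.of fun i j => leftTranslation (g j) (Sum.elim (fun _ => a) w i)).map
      (rightTranslation π x) = E * (Matrix.of fun i j => leftTranslation (g j)
        (Sum.elim (fun _ => (coordinateAction π).act x a) w i)) := by
    ext i j
    rw [Matrix.map_apply, Matrix.of_apply, Matrix.mul_apply, Fintype.sum_sum_type]
    refine (coordinateAction_act_leftTranslation π x (g j) _).trans ?_
    rcases i with ⟨⟩ | i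
    · simp [E]
    · simp [E, hD, Algebra.smul_def]
  rw [translatesDet_apply, translatesDet_apply, Algebra.smul_def, ← hE, ← Matrix.det_mul, ← h]
  exact (rightTranslation π x).toRingHom.map_det _

/-- A stable finite dimensional subspace of `k[G]` not containing `1` is killed by a linear map
which does not kill `1` and is equivariant up to a character. -/
lemma exists_semiequivariant (W : Submodule k A) [FiniteDimensional k W]
    (hW : ∀ x, ∀ a ∈ W, (coordinateAction π).act x a ∈ W) (h1 : (1 : A) ∉ W) :
    ∃ (s : A →ₗ[k] A) (χ : Points k B → k), (∀ a ∈ W, s a = 0) ∧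
      (∀ x a, (coordinateAction π).act x (s a) = χ x • s ((coordinateAction π).act x a)) ∧
      (1 : Points k A) (s 1) ≠ 0 := by
  let b := Module.finBasis k W
  let w : Fin (Module.finrank k W) → A := fun i => b i
  have hli : LinearIndependent k (Sum.elim (fun _ : Unit => (1 : A)) w) := by
    refine LinearIndependent.sum_type ?_ (b.linearIndependent.map' W.subtype W.ker_subtype) ?_
    · exact LinearIndependent.of_subsingleton () fun h => h1 (h ▸ W.zero_mem)
    · rw [Submodule.disjoint_def]
      intro y hy hy'
      have hyW : y ∈ W := by
        refine Submodule.span_le.2 ?_ hy'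
        rintro _ ⟨i, rfl⟩
        exact (b i).2
      rw [Set.range_const, Submodule.mem_span_singleton] at hy
      obtain ⟨c, rfl⟩ := hy
      rcases eq_or_ne c 0 with rfl | hc
      · simp
      · exact absurd ((W.smul_mem_iff hc).1 hyW) h1
  obtain ⟨g, hg⟩ := exists_points_det_ne_zero hli
  refine ⟨translatesDet w g, fun x => (Matrix.of fun i l =>
    b.repr ⟨(coordinateAction π).act x (b i), hW x _ (b i).2⟩ l).det, fun a ha => ?_,
    fun x a => act_translatesDet π w g x _ (fun i => ?_) a, ?_⟩
  · have hker : W ≤ LinearMap.ker (translatesDet w g) := by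
      have hspan : W = Submodule.span k (Set.range w) := by
        have := congrArg (Submodule.map W.subtype) b.span_eq
        rw [Submodule.map_span, Submodule.map_top, Submodule.range_subtype, ← Set.range_comp]
          at this
        exact this.symm
      refine hspan.le.trans (Submodule.span_le.2 ?_)
      rintro _ ⟨i, rfl⟩
      change translatesDet w g (w i) = 0
      rw [translatesDet_apply]
      -- For `a = w i` the matrix has two equal rows.
      exact Matrix.det_zero_of_row_eq (i := Sum.inl ()) (j := Sum.inr i) (by simp) rfl
    exact hker ha
  · have := congrArg Subtype.val
      (b.sum_repr ⟨(coordinateAction π).act x (b i), hW x _ (b i).2⟩)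
    rw [AddSubmonoidClass.coe_finsetSum] at this
    exact this.symm
  · rw [translatesDet_apply]
    have := ((1 : Points k A).ofConv : A →+* k).map_det
      (Matrix.of fun i j => leftTranslation (g j) (Sum.elim (fun _ => (1 : A)) w i))
    refine ne_of_eq_of_ne this ?_
    rw [← Matrix.det_transpose]
    convert hg using 2
    ext i j
    change (1 : Points k A) (leftTranslation (g i) _) = _
    rw [apply_leftTranslation, mul_one]
    rfl

end Determinants

lemma exists_comp_eq_of_ker_le {k U V W : Type*} [Field k] [AddCommGroup U] [Module k U]
    [AddCommGroup V] [Module k V] [AddCommGroup W] [Module k W] {f : U →ₗ[k] V} {g : U →ₗ[k] W}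
    (h : LinearMap.ker f ≤ LinearMap.ker g) : ∃ t : V →ₗ[k] W, t ∘ₗ f = g := by
  obtain ⟨t, ht⟩ := LinearMap.exists_extend
    ((LinearMap.ker f).liftQ g h ∘ₗ f.quotKerEquivRange.symm.toLinearMap)
  refine ⟨t, LinearMap.ext fun v => (LinearMap.congr_fun ht ⟨f v, v, rfl⟩).trans ?_⟩
  rw [LinearMap.comp_apply, LinearEquiv.coe_coe]
  erw [LinearMap.quotKerEquivRange_symm_apply_image]
  rfl

/-! ### Affine quotients give local integrals -/

section AffineQuotient

variable {k A B : Type u} [Field k] [CommRing A] [HopfAlgebra k A] [CommRing B] [HopfAlgebra k B]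
variable (π : A →ₐc[k] B)

lemma coe_mul_inclusion (x : Points k A) (h : Points k B) :
    ((x * inclusion π h : Points k A) : HomogeneousSpace π) = x :=
  (QuotientGroup.mk_mul_of_mem x ⟨h, rfl⟩)

/-- A subset of `G` stable under right multiplication by `H` is the inverse image of a subset of
`G/H`. -/
lemma preimage_image_coe {U : Set (Points k A)}
    (hU : ∀ x ∈ U, ∀ h : Points k B, x * inclusion π h ∈ U) :
    (fun x : Points k A => (x : HomogeneousSpace π)) ⁻¹'
      ((fun x : Points k A => (x : HomogeneousSpace π)) '' U) = U := by
  refine Set.Subset.antisymm ?_ (Set.subset_preimage_image _ U)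
  rintro y ⟨x, hx, hxy⟩
  obtain ⟨h, hh⟩ := QuotientGroup.eq.1 hxy
  have := hU x hx h
  rwa [hh, mul_inv_cancel_left] at this

lemma isOpen_image_coe {U : Set (Points k A)} (hUo : IsOpen U)
    (hU : ∀ x ∈ U, ∀ h : Points k B, x * inclusion π h ∈ U) :
    IsOpen ((fun x : Points k A => (x : HomogeneousSpace π)) '' U) := by
  refine isOpen_coinduced.2 ?_
  convert hUo
  exact preimage_image_coe π hU

variable {π} [IsAlgClosed k] [Algebra.FiniteType k A]
variable {C : Type u} [CommRing C] [Algebra k C] {e : HomogeneousSpace π ≃ₜ Points k C}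

/-- Global regular functions on `G` are polynomial. With `exists_eq_pullback` this identifies the
functions on `G/H` with the invariants in `k[G]`. -/
lemma exists_pullback (he : ∀ U : Set (Points k C), IsOpen U → ∀ f : Points k C → k,
      IsRegularOn U f ↔ IsRegularOnQuotient π (e ⁻¹' U) (f ∘ e)) (a : C) :
    ∃ c : A, ∀ x : Points k A, x c = e x a := by
  have := (he Set.univ isOpen_univ _).1 (isRegularOn_eval Set.univ a)
  obtain ⟨c, hc⟩ := IsRegularOn.exists_eq_eval
    (f := fun x : Points k A => e (x : HomogeneousSpace π) a) this
  exact ⟨c, fun x => (hc x).symm⟩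

variable [IsReduced A]

lemma mem_invariants_of_pullback {a : C} {c : A} (hc : ∀ x : Points k A, x c = e x a) :
    c ∈ (coordinateAction π).invariants := by
  rw [mem_invariants_coordinateAction]
  intro y x
  rw [hc, hc, coe_mul_inclusion]

lemma exists_eq_pullback [Algebra.FiniteType k C]
    (he : ∀ U : Set (Points k C), IsOpen U → ∀ f : Points k C → k,
      IsRegularOn U f ↔ IsRegularOnQuotient π (e ⁻¹' U) (f ∘ e))
    {c : A} (hc : c ∈ (coordinateAction π).invariants) :
    ∃ a : C, ∀ x : Points k A, x c = e x a := by
  rw [mem_invariants_coordinateAction] at hc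
  let f : HomogeneousSpace π → k := Quotient.lift (fun x : Points k A => x c) (by
    intro x y hxy
    obtain ⟨h, hh⟩ := QuotientGroup.leftRel_apply.1 hxy
    have := hc x h
    rw [hh, mul_inv_cancel_left] at this
    exact this.symm)
  have hf : IsRegularOn Set.univ (f ∘ e.symm) := by
    rw [he Set.univ isOpen_univ]
    have : (f ∘ e.symm) ∘ e = f := by ext; simp
    rw [this]
    exact isRegularOn_eval _ c
  obtain ⟨a, ha⟩ := hf.exists_eq_eval
  refine ⟨a, fun x => ?_⟩
  rw [← ha]
  simp [f]

/-- If `G/H` is affine, a nonempty principal open subset of `G` stable under `H` contains a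
nonempty one which is defined by an invariant function. -/
lemma exists_invariant_of_semiinvariant
    (he : ∀ U : Set (Points k C), IsOpen U → ∀ f : Points k C → k,
      IsRegularOn U f ↔ IsRegularOnQuotient π (e ⁻¹' U) (f ∘ e))
    {c : A} (hc : ∀ x : Points k A, x c ≠ 0 → ∀ h : Points k B, (x * inclusion π h) c ≠ 0)
    {x₀ : Points k A} (hx₀ : x₀ c ≠ 0) :
    ∃ c' ∈ (coordinateAction π).invariants, x₀ c' ≠ 0 ∧
      ∀ x : Points k A, x c = 0 → x c' = 0 := by
  have hopen := isOpen_image_coe π (isOpen_ne_zero (k := k) c) hc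
  have hopen' := e.symm.continuous.isOpen_preimage _ hopen
  obtain ⟨a, ha, haU⟩ := exists_ne_zero_subset hopen' (x := e x₀)
    ⟨x₀, hx₀, (e.symm_apply_apply _).symm⟩
  obtain ⟨c', hc'⟩ := exists_pullback he a
  refine ⟨c', mem_invariants_of_pullback hc', by rwa [hc'], fun x hx => ?_⟩
  by_contra hxc
  rw [hc'] at hxc
  have := haU _ hxc
  rw [Set.mem_preimage, e.symm_apply_apply] at this
  have hx' : x ∈ (fun x : Points k A => (x : HomogeneousSpace π)) ⁻¹'
    ((fun x : Points k A => (x : HomogeneousSpace π)) '' {x | x c ≠ 0}) := this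
  rw [preimage_image_coe π (U := {x | x c ≠ 0}) hc] at hx'
  exact hx' hx

/-- The linear maps `k[G] → k[G]` which are equivariant and kill `W`. -/
def IsEquivariantKilling (π : A →ₐc[k] B) (W : Submodule k A) (s : A →ₗ[k] A) : Prop :=
  (∀ a ∈ W, s a = 0) ∧
    ∀ x a, (coordinateAction π).act x (s a) = s ((coordinateAction π).act x a)

lemma IsEquivariantKilling.map_one_mem {W : Submodule k A} {s : A →ₗ[k] A}
    (hs : IsEquivariantKilling π W s) : s 1 ∈ (coordinateAction π).invariants := fun x => by
  rw [hs.2, coordinateAction_act_one]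

/-- The semi-equivariant map `s` has a semi-invariant value `c = s 1`, whose nonvanishing locus is
therefore `H`-stable. Affineness gives an invariant `c'` vanishing wherever `c` does, so `c' ^ n = d
* c`, and `d` serves to cancel the character `χ` of `c`. -/
lemma exists_equivariantKilling
    (he : ∀ U : Set (Points k C), IsOpen U → ∀ f : Points k C → k,
      IsRegularOn U f ↔ IsRegularOnQuotient π (e ⁻¹' U) (f ∘ e))
    (W : Submodule k A) [FiniteDimensional k W]
    (hW : ∀ x, ∀ a ∈ W, (coordinateAction π).act x a ∈ W) (h1 : (1 : A) ∉ W) (y : Points k A) :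
    ∃ s : A →ₗ[k] A, IsEquivariantKilling π W s ∧ y (s 1) ≠ 0 := by
  obtain ⟨s, χ, hsW, hs, hs1⟩ := exists_semiequivariant π W hW h1
  set c := s 1 with hcdef
  have hc : ∀ h, (coordinateAction π).act h c = χ h • c := fun h => by
    rw [hs, coordinateAction_act_one]
  have hc0 : c ≠ 0 := by
    rintro h0
    exact hs1 (by rw [h0, map_zero])
  have hχ : ∀ h, χ h ≠ 0 := by
    intro h h0
    have := (coordinateAction π).act_inv_act h c
    rw [hc, h0, zero_smul, map_zero] at this
    exact hc0 this.symm
  obtain ⟨c', hc', hc'1, hcc'⟩ := exists_invariant_of_semiinvariant he (c := c)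
    (fun x hx h => by
      rw [← apply_coordinateAction_act, hc, map_smul]
      exact smul_ne_zero (hχ h) hx) hs1
  obtain ⟨n, d, hd⟩ := exists_pow_eq_mul_of_zeros_subset hcc'
  have hinv : ∀ h, (coordinateAction π).act h d * (χ h • c) = d * c := by
    intro h
    rw [← hc, ← coordinateAction_act_mul, ← hd]
    exact (invariantSubalgebra π).pow_mem hc' n h
  -- Since `c` may be a zero divisor, it cannot be cancelled to show that `d` itself has character
  -- `χ⁻¹`; but `d * d * c` does.
  have hd' : ∀ h, χ h • (coordinateAction π).act h (d * d * c) = d * d * c := by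
    intro h
    have h₁ := hinv h
    rw [coordinateAction_act_mul, coordinateAction_act_mul, hc]
    calc χ h • ((coordinateAction π).act h d * (coordinateAction π).act h d * χ h • c)
        = χ h • (coordinateAction π).act h d * ((coordinateAction π).act h d * χ h • c) := by
          simp only [Algebra.smul_def]; ring
      _ = d * ((coordinateAction π).act h d * χ h • c) := by
          rw [h₁]; rw [mul_left_comm, ← h₁]; simp only [Algebra.smul_def]; ring
      _ = d * d * c := by rw [h₁, mul_assoc]
  have hval : (1 : Points k A) (d * d * c * c) ≠ 0 := by
    have : d * d * c * c = (c' ^ n) ^ 2 := by rw [hd]; ring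
    rw [this, map_pow, map_pow]
    exact pow_ne_zero _ (pow_ne_zero _ hc'1)
  -- Left translation commutes with `H` and carries nonvanishing from the identity to `y`.
  refine ⟨(leftTranslation y⁻¹).toLinearMap ∘ₗ LinearMap.mulLeft k (d * d * c) ∘ₗ s,
    ⟨fun a ha => ?_, fun h a => ?_⟩, ?_⟩
  · simp [hsW a ha]
  · change (coordinateAction π).act h (leftTranslation y⁻¹ (d * d * c * s a)) =
      leftTranslation y⁻¹ (d * d * c * s _)
    rw [coordinateAction_act_leftTranslation]
    congr 1
    rw [coordinateAction_act_mul, hs, mul_smul_comm, ← smul_mul_assoc, hd']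
  · change y (leftTranslation y⁻¹ (d * d * c * c)) ≠ 0
    rwa [apply_leftTranslation, inv_mul_cancel]

/-- The values at `1` of equivariant maps killing `W` are invariants, stable under multiplication by
invariants. As functions on `G/H` they form an ideal without common zero, hence the unit ideal. -/
lemma exists_equivariantKilling_map_one [Algebra.FiniteType k C] [IsReduced C]
    (he : ∀ U : Set (Points k C), IsOpen U → ∀ f : Points k C → k,
      IsRegularOn U f ↔ IsRegularOnQuotient π (e ⁻¹' U) (f ∘ e))
    (W : Submodule k A) [FiniteDimensional k W]
    (hW : ∀ x, ∀ a ∈ W, (coordinateAction π).act x a ∈ W) (h1 : (1 : A) ∉ W) :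
    ∃ s : A →ₗ[k] A, IsEquivariantKilling π W s ∧ s 1 = 1 := by
  let J : Ideal C :=
    { carrier := {a | ∃ s : A →ₗ[k] A, IsEquivariantKilling π W s ∧
        ∀ x : Points k A, x (s 1) = e x a}
      add_mem' := by
        rintro a b ⟨s, hs, hsa⟩ ⟨t, ht, htb⟩
        exact ⟨s + t, ⟨fun w hw => by simp [hs.1 w hw, ht.1 w hw],
          fun x w => by simp [hs.2, ht.2]⟩, fun x => by simp [hsa, htb]⟩
      zero_mem' := ⟨0, ⟨by simp, by simp⟩, by simp⟩
      smul_mem' := by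
        rintro r a ⟨s, hs, hsa⟩
        obtain ⟨c, hc⟩ := exists_pullback he r
        have hcinv := mem_invariants_of_pullback hc
        refine ⟨LinearMap.mulLeft k c ∘ₗ s, ⟨fun w hw => by simp [hs.1 w hw], fun x w => ?_⟩,
          fun x => by simp [hsa, hc]⟩
        simp only [LinearMap.comp_apply, LinearMap.mulLeft_apply]
        rw [coordinateAction_act_mul, hcinv x, hs.2] }
  have hJ : J = ⊤ := by
    apply ideal_eq_top_of_forall_point (k := k)
    intro y
    obtain ⟨x, hx⟩ := QuotientGroup.mk_surjective (e.symm y)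
    obtain ⟨s, hs, hsx⟩ := exists_equivariantKilling he W hW h1 x
    obtain ⟨a, ha⟩ := exists_eq_pullback he hs.map_one_mem
    refine ⟨a, ⟨s, hs, ha⟩, ?_⟩
    have hxy : e (x : HomogeneousSpace π) = y := by
      rw [show (x : HomogeneousSpace π) = e.symm y from hx, e.apply_symm_apply]
    rwa [ha, hxy] at hsx
  obtain ⟨s, hs, hs1⟩ := (Ideal.eq_top_iff_one J).1 hJ
  exact ⟨s, hs, eq_of_forall_point (k := k) fun x => by rw [hs1, map_one, map_one]⟩

lemma IsAffineHomogeneousSpace.hasLocalIntegrals [Algebra.FiniteType k B] [IsReduced B]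
    (hπ : Function.Surjective π) (h : IsAffineHomogeneousSpace π) : HasLocalIntegrals π := by
  obtain ⟨C, _, _, _, _, e, he⟩ := h
  have : Nontrivial B := (Bialgebra.counitAlgHom k B).toRingHom.domain_nontrivial
  intro S hS
  choose l hl using hπ
  let ρ := coordinateAction π
  let V := ρ.stableSpan (insert 1 (l '' S))
  have hVS := ρ.subset_stableSpan (insert 1 (l '' S))
  have hV : ∀ x, ∀ a ∈ V, ρ.act x a ∈ V := fun x a ha => ρ.act_mem_stableSpan _ x ha
  have hVfin : FiniteDimensional k V := ρ.finiteDimensional_stableSpan ((hS.image l).insert 1)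
  let W := V ⊓ LinearMap.ker (π : A →ₗ[k] B)
  have hWfin : FiniteDimensional k W := Submodule.finiteDimensional_of_le inf_le_left
  obtain ⟨s, hs, hs1⟩ := exists_equivariantKilling_map_one he W
    (fun x a ha => ⟨hV x a ha.1, by
      have h0 : π a = 0 := ha.2
      change π (ρ.act x a) = 0
      rw [map_coordinateAction_act, h0, map_zero]⟩)
    (fun h1 => one_ne_zero (α := B) (by rw [← map_one π]; exact h1.2))
  obtain ⟨τ, hτ⟩ := exists_comp_eq_of_ker_le (f := (π : A →ₗ[k] B) ∘ₗ V.subtype)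
    (g := s ∘ₗ V.subtype) (fun v hv => hs.1 v ⟨v.2, hv⟩)
  have hτ' : ∀ v ∈ V, τ (π v) = s v := fun v hv => LinearMap.congr_fun hτ ⟨v, hv⟩
  have h1V : (1 : A) ∈ V := hVS (Set.mem_insert _ _)
  refine ⟨τ, by rw [← map_one π, hτ' 1 h1V, hs1], fun b hb x => ?_⟩
  have hbV : l b ∈ V := hVS (Set.mem_insert_of_mem _ ⟨b, hb, rfl⟩)
  rw [← hl b, ← map_coordinateAction_act, hτ' _ (hV x _ hbV), hτ' _ hbV, hs.2]

end AffineQuotient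

/-! ### Generic finite generation of subalgebras -/

section FiniteGeneration

/-- The generic fibre is nonzero by flatness, and by Zariski's lemma its residue field at a maximal
ideal is finite over the fraction field. -/
lemma exists_field_of_injective {R A : Type u} [CommRing R] [IsDomain R] [CommRing A] [Algebra R A]
    [Algebra.FiniteType R A] (h : Function.Injective (algebraMap R A)) :
    ∃ (L : Type u) (_ : Field L) (_ : Algebra R L) (_ : Algebra (FractionRing R) L)
      (_ : IsScalarTower R (FractionRing R) L), Module.Finite (FractionRing R) L ∧
      Nonempty (A →ₐ[R] L) := by
  have hnt : Nontrivial (FractionRing R ⊗[R] A) := by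
    have hinj := Module.Flat.lTensor_preserves_injective_linearMap (M := FractionRing R)
      (Algebra.linearMap R A) h
    have : Nontrivial (FractionRing R ⊗[R] R) := (TensorProduct.rid R (FractionRing R)).nontrivial
    exact hinj.nontrivial
  obtain ⟨m, hm⟩ := Ideal.exists_maximal (FractionRing R ⊗[R] A)
  let _ : Field ((FractionRing R ⊗[R] A) ⧸ m) := Ideal.Quotient.field m
  refine ⟨(FractionRing R ⊗[R] A) ⧸ m, inferInstance, inferInstance, inferInstance, inferInstance,
    finite_of_finite_type_of_isJacobsonRing (FractionRing R) _,
    ⟨((Ideal.Quotient.mkₐ R m).comp Algebra.TensorProduct.includeRight)⟩⟩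

variable {k : Type u} [Field k]

/-- A subalgebra of a finitely generated algebra is finitely generated after inverting one
element, if it is a domain. -/
lemma exists_fg_subalgebra_pow_mul_mem_of_isDomain {R A : Type u} [CommRing R] [IsDomain R]
    [Algebra k R] [CommRing A] [Algebra k A] [Algebra R A] [IsScalarTower k R A]
    [Algebra.FiniteType k A] (h : Function.Injective (algebraMap R A)) :
    ∃ f : R, f ≠ 0 ∧ ∃ C : Subalgebra k R, C.FG ∧ f ∈ C ∧ ∀ r, ∃ n : ℕ, f ^ n * r ∈ C := by
  classical
  have := Algebra.FiniteType.of_restrictScalars_finiteType k R A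
  obtain ⟨L, _, _, _, _, hfin, ⟨φ⟩⟩ := exists_field_of_injective h
  have hRL : Function.Injective (algebraMap R L) := by
    rw [IsScalarTower.algebraMap_eq R (FractionRing R) L]
    exact (algebraMap (FractionRing R) L).injective.comp (IsFractionRing.injective R _)
  let _ : Algebra k L := ((algebraMap R L).comp (algebraMap k R)).toAlgebra
  have : IsScalarTower k R L := IsScalarTower.of_algebraMap_eq fun _ => rfl
  obtain ⟨t, ht⟩ := (inferInstance : Algebra.FiniteType k A).out
  have := Algebra.IsIntegral.of_finite (FractionRing R) L
  have hint : ∀ a : A, ∃ m : nonZeroDivisors R, IsIntegral R (m • φ a) := fun a =>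
    IsIntegral.exists_multiple_integral_of_isLocalization (Rₘ := FractionRing R) (nonZeroDivisors R)
      (φ a) (Algebra.IsIntegral.isIntegral (φ a))
  choose m hm using hint
  let f : R := ∏ a ∈ t, (m a : R)
  have hf0 : f ≠ 0 := Finset.prod_ne_zero_iff.2 fun a _ => nonZeroDivisors.coe_ne_zero (m a)
  have hft : ∀ a ∈ t, IsIntegral R (algebraMap R L f * φ a) := by
    intro a ha
    have : algebraMap R L f * φ a =
        algebraMap R L (∏ b ∈ t.erase a, (m b : R)) * (m a • φ a) := by
      rw [Submonoid.smul_def, Algebra.smul_def, ← mul_assoc, ← map_mul, mul_comm (∏ b ∈ _, _),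
        Finset.mul_prod_erase t (fun b => (m b : R)) ha]
    rw [this]
    exact isIntegral_algebraMap.mul (hm a)
  choose! p hp_monic hp using hft
  -- With the coefficients of the integral equations adjoined, the elements `f * φ a` are integral
  -- over a finitely generated, hence Noetherian, algebra `C₀`.
  let s : Finset R := insert f (t.biUnion fun a => (p a).coeffs)
  let C₀ : Subalgebra k R := Algebra.adjoin k (s : Set R)
  have hfC₀ : f ∈ C₀ := Algebra.subset_adjoin (by simp [s])
  have hint₀ : ∀ a ∈ t, IsIntegral C₀ (algebraMap R L f * φ a) := by
    intro a ha
    have hcoeff : (↑(p a).coeffs : Set R) ⊆ C₀.toSubring := by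
      intro c hc
      refine Algebra.subset_adjoin ?_
      simp only [s, Finset.coe_insert, Finset.coe_biUnion]
      exact Or.inr (Set.mem_biUnion (Finset.mem_coe.2 ha) hc)
    refine ⟨(p a).toSubring C₀.toSubring hcoeff,
      (Polynomial.monic_toSubring _ _ _).2 (hp_monic a ha), ?_⟩
    have h₁ := hp a ha
    rw [← Polynomial.map_toSubring (p a) C₀.toSubring hcoeff, Polynomial.eval₂_map] at h₁
    exact h₁
  let u : Finset L := t.image fun a => algebraMap R L f * φ a
  let D : Subalgebra C₀ L := Algebra.adjoin C₀ (u : Set L)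
  have hDfin : Module.Finite C₀ D := by
    refine Module.Finite.iff_fg.2 (fg_adjoin_of_finite u.finite_toSet ?_)
    intro x hx
    obtain ⟨a, ha, rfl⟩ := Finset.mem_image.1 (Finset.mem_coe.1 hx)
    exact hint₀ a ha
  have hC₀ft : Algebra.FiniteType k C₀ :=
    (Subalgebra.fg_iff_finiteType _).1 (Subalgebra.fg_adjoin_finset s)
  have hC₀noeth : IsNoetherianRing C₀ := Algebra.FiniteType.isNoetherianRing k C₀
  -- `E = R ∩ D` is a submodule of the finite module `D` over `C₀`, hence finite; it contains `f ^ n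
  -- * r` as soon as `D` does.
  let E : Subalgebra C₀ R := D.comap (IsScalarTower.toAlgHom C₀ R L)
  have hEfin : Module.Finite C₀ E := by
    let j : E →ₗ[C₀] D := ((IsScalarTower.toAlgHom C₀ R L).toLinearMap ∘ₗ
      E.val.toLinearMap).codRestrict D.toSubmodule fun x => x.2
    refine Module.Finite.of_injective j fun x y hxy => Subtype.ext (hRL ?_)
    exact congrArg Subtype.val hxy
  have hEft : Algebra.FiniteType k E :=
    Algebra.FiniteType.trans hC₀ft inferInstance
  refine ⟨f, hf0, E.restrictScalars k, (Subalgebra.fg_iff_finiteType _).2 hEft,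
    E.algebraMap_mem ⟨f, hfC₀⟩, ?_⟩
  have hfD : algebraMap R L f ∈ D := D.algebraMap_mem ⟨f, hfC₀⟩
  have key : ∀ a : A, ∃ n : ℕ, algebraMap R L f ^ n * φ a ∈ D := by
    intro a
    have ha : a ∈ Algebra.adjoin k (t : Set A) := ht ▸ Algebra.mem_top
    induction ha using Algebra.adjoin_induction with
    | mem a ha =>
      refine ⟨1, ?_⟩
      rw [pow_one]
      exact Algebra.subset_adjoin (Finset.mem_coe.2 (Finset.mem_image_of_mem _ ha))
    | algebraMap r =>
      refine ⟨0, ?_⟩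
      rw [pow_zero, one_mul, IsScalarTower.algebraMap_apply k R A, AlgHom.commutes]
      exact D.algebraMap_mem (algebraMap k C₀ r)
    | add a b _ _ ha hb =>
      obtain ⟨n, hn⟩ := ha
      obtain ⟨l, hl⟩ := hb
      refine ⟨n + l, ?_⟩
      have : algebraMap R L f ^ (n + l) * φ (a + b) =
          algebraMap R L f ^ l * (algebraMap R L f ^ n * φ a) +
            algebraMap R L f ^ n * (algebraMap R L f ^ l * φ b) := by
        rw [map_add]; ring
      rw [this]
      exact add_mem (mul_mem (pow_mem hfD _) hn) (mul_mem (pow_mem hfD _) hl)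
    | mul a b _ _ ha hb =>
      obtain ⟨n, hn⟩ := ha
      obtain ⟨l, hl⟩ := hb
      refine ⟨n + l, ?_⟩
      have : algebraMap R L f ^ (n + l) * φ (a * b) =
          (algebraMap R L f ^ n * φ a) * (algebraMap R L f ^ l * φ b) := by
        rw [map_mul]; ring
      rw [this]
      exact mul_mem hn hl
  intro r
  obtain ⟨n, hn⟩ := key (algebraMap R A r)
  refine ⟨n, ?_⟩
  rw [AlgHom.commutes, ← map_pow, ← map_mul] at hn
  exact hn

/-- A subalgebra of a finitely generated reduced algebra is finitely generated after inverting one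
nonzero element. -/
lemma exists_fg_subalgebra_pow_mul_mem {A : Type u} [CommRing A] [Nontrivial A] [Algebra k A]
    [Algebra.FiniteType k A] [IsReduced A] (C : Subalgebra k A) :
    ∃ f ∈ C, f ≠ 0 ∧ ∃ C₀ ≤ C, C₀.FG ∧ ∀ c ∈ C, ∃ n : ℕ, f ^ n * c ∈ C₀ := by
  classical
  have : IsNoetherianRing A := Algebra.FiniteType.isNoetherianRing k A
  let S : Set (Ideal C) := (fun P : Ideal A => P.comap C.val) '' minimalPrimes A
  have hSfin : S.Finite := (minimalPrimes.finite_of_isNoetherianRing A).image _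
  have hSne : S.Nonempty := by
    obtain ⟨m, hm⟩ := Ideal.exists_maximal A
    obtain ⟨P, hP, -⟩ := Ideal.exists_minimalPrimes_le (bot_le : ⊥ ≤ m)
    exact ⟨_, P, hP, rfl⟩
  have hSprime : ∀ q ∈ S, q.IsPrime := by
    rintro _ ⟨P, hP, rfl⟩
    have := hP.1.1
    exact Ideal.comap_isPrime _ _
  have hSinf : ∀ c : C, (∀ q ∈ S, c ∈ q) → c = 0 := by
    intro c hc
    have : (c : A) ∈ sInf (minimalPrimes A) := Ideal.mem_sInf.2 fun {P} hP => hc _ ⟨P, hP, rfl⟩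
    rw [minimalPrimes, Ideal.sInf_minimalPrimes] at this
    have h0 : IsNilpotent (c : A) := this
    exact Subtype.ext h0.eq_zero
  obtain ⟨q, hqS, hqmin⟩ := hSfin.exists_minimal hSne
  have hq := hSprime q hqS
  obtain ⟨P, hP, hPq⟩ := hqS
  have hPprime : P.IsPrime := hP.1.1
  -- Multiplying by `g` isolates the component of `q`: `g` lies in all the other contracted primes
  -- but, by minimality of `q`, can be chosen outside `q`.
  have hg : ∃ g : C, g ∉ q ∧ ∀ z ∈ q, g * z = 0 := by
    have hex : ∀ q' ∈ S, q' ≠ q → ∃ g ∈ q', g ∉ q := fun q' hq' hne => by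
      by_contra! hle
      exact hne (le_antisymm hle (hqmin hq' hle))
    choose! g hgq' hgq using hex
    refine ⟨∏ q' ∈ hSfin.toFinset.erase q, g q', fun h => ?_, fun z hz => hSinf _ fun q' hq' => ?_⟩
    · obtain ⟨q', hq', hmem⟩ := (hq.prod_mem_iff).1 h
      rw [Finset.mem_erase, Set.Finite.mem_toFinset] at hq'
      exact hgq q' hq'.2 hq'.1 hmem
    · rcases eq_or_ne q' q with rfl | hne
      · exact Ideal.mul_mem_left _ _ hz
      · refine Ideal.mul_mem_right _ _ (Ideal.mem_of_dvd _ (Finset.dvd_prod_of_mem g ?_)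
          (hgq' q' hq' hne))
        simp [hne, hq']
  obtain ⟨g, hgq, hgz⟩ := hg
  let ψ : (C ⧸ q) →ₐ[k] (A ⧸ P) := Ideal.quotientMapₐ P C.val hPq.ge
  have hψ : Function.Injective ψ := Ideal.quotientMap_injective' (H := hPq.ge) hPq.le
  let _ : Algebra (C ⧸ q) (A ⧸ P) := ψ.toRingHom.toAlgebra
  have : IsScalarTower k (C ⧸ q) (A ⧸ P) :=
    IsScalarTower.of_algebraMap_eq fun r => (ψ.commutes r).symm
  obtain ⟨f', hf', D, ⟨t, ht⟩, hfD, hD⟩ :=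
    exists_fg_subalgebra_pow_mul_mem_of_isDomain (k := k) (R := C ⧸ q) (A := A ⧸ P) hψ
  obtain ⟨f, rfl⟩ := Ideal.Quotient.mk_surjective f'
  choose l hl using Ideal.Quotient.mk_surjective (I := q)
  let s : Finset C := insert f (insert g (t.image l))
  let E : Subalgebra k C := Algebra.adjoin k (s : Set C)
  have hfE : f ∈ E := Algebra.subset_adjoin (by simp [s])
  have hgE : g ∈ E := Algebra.subset_adjoin (by simp [s])
  have hDE : D ≤ E.map (Ideal.Quotient.mkₐ k q) := by
    rw [← ht, Algebra.adjoin_le_iff]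
    intro x hx
    exact ⟨l x, Algebra.subset_adjoin (by
      simp only [s, Finset.coe_insert, Finset.coe_image]
      exact Or.inr (Or.inr ⟨x, hx, rfl⟩)), hl x⟩
  have hfq : f ∉ q := fun h => hf' (Ideal.Quotient.eq_zero_iff_mem.2 h)
  refine ⟨(f * g : C), (f * g).2, fun h => ?_, E.map C.val, ?_,
    (Subalgebra.fg_adjoin_finset s).map _, fun c hc => ?_⟩
  · have h0 : f * g = 0 := Subtype.ext h
    exact (hq.mem_or_mem (h0 ▸ q.zero_mem : f * g ∈ q)).elim hfq hgq
  · rintro _ ⟨x, -, rfl⟩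
    exact x.2
  · obtain ⟨n, hn⟩ := hD (Ideal.Quotient.mk q ⟨c, hc⟩)
    obtain ⟨y, hyE, hy⟩ := hDE hn
    have hyz : f ^ n * ⟨c, hc⟩ - y ∈ q := by
      rw [← Ideal.Quotient.eq_zero_iff_mem, map_sub, map_mul, map_pow, sub_eq_zero]
      exact hy.symm
    have hgy : g * (f ^ n * ⟨c, hc⟩) = g * y := by
      rw [← sub_eq_zero, ← mul_sub]
      exact hgz _ hyz
    refine ⟨n + 1, f * g ^ n * (g * y), ?_, ?_⟩
    · exact mul_mem (mul_mem hfE (pow_mem hgE n)) (mul_mem hgE hyE)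
    · rw [← hgy]
      change ((f : A) * (g : A) ^ n * ((g : A) * ((f : A) ^ n * c))) =
        ((f : A) * (g : A)) ^ (n + 1) * c
      ring

end FiniteGeneration

/-! ### The Reynolds operator of a total integral -/

section Reynolds

variable {k A B : Type u} [Field k] [CommRing A] [HopfAlgebra k A] [CommRing B] [HopfAlgebra k B]
variable [IsAlgClosed k] [Algebra.FiniteType k A] [IsReduced A]

/-- The algebra `k[G]` as a `(k[G], H)`-module. -/
def coordinateModule (π : A →ₐc[k] B) : EquivariantModule π where
  carrier := A
  action := coordinateAction π
  act_smul := coordinateAction_act_mul π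

/-- The operator `a ↦ ∑ σ (S (π a₂)) a₁` on `k[G]`. -/
def reynolds (π : A →ₐc[k] B) (σ : B →ₗ[k] A) : A →ₗ[k] A :=
  (coordinateModule π).average σ

variable [Algebra.FiniteType k B] [IsReduced B] {π : A →ₐc[k] B} {σ : B →ₗ[k] A}

lemma IsTotalIntegral.reynolds_mem (hσ : IsTotalIntegral π σ) (a : A) :
    reynolds π σ a ∈ invariantSubalgebra π := by
  obtain ⟨n, v, c, hvc⟩ := exists_eq_sum_tmul (s := (coordinateAction π).coactInv a)
  exact (coordinateModule π).average_mem_invariants hvc fun x i => hσ.map_act x (c i)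

lemma IsTotalIntegral.reynolds_one (hσ : IsTotalIntegral π σ) : reynolds π σ 1 = 1 :=
  (coordinateModule π).average_of_mem_invariants hσ.map_one (m := (1 : A))
    fun x => coordinateAction_act_one π x

/-- The value of `reynolds π σ a` at `x` depends linearly on the restriction of `a` to `xH`. -/
lemma apply_reynolds_eq_smul {x : Points k A} {a b : A} {r : k}
    (h : ∀ y : Points k B, (x * inclusion π y) a = r * (x * inclusion π y) b) :
    x (reynolds π σ a) = r * x (reynolds π σ b) := by
  -- Evaluating the first factor at `x` turns `∑ a₁ ⊗ S (π a₂)` into the function `y ↦ a (x y⁻¹)` on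
  -- `H`, which sees only the restriction of `a` to `xH`.
  let φ : A ⊗[k] B →ₗ[k] B :=
    (TensorProduct.lid k B).toLinearMap ∘ₗ x.ofConv.toLinearMap.rTensor B
  have hφ : ∀ t : A ⊗[k] B, x (smulVia σ A t) = x (σ (φ t)) := by
    intro t
    induction t with
    | zero => simp
    | tmul v c => simp [φ, mul_comm]
    | add s t hs ht => simp only [map_add, hs, ht]
  have hev : ∀ (y : Points k B) (t : A ⊗[k] B), y (φ t) = x (evalRight A y t) := by
    intro y t
    induction t with
    | zero => simp
    | tmul v c => simp [φ, mul_comm]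
    | add s t hs ht => simp only [map_add, hs, ht]
  have hval : φ ((coordinateAction π).coactInv a) = r • φ ((coordinateAction π).coactInv b) := by
    apply eq_of_forall_point (k := k)
    intro y
    rw [map_smul, hev, hev, RationalAction.evalRight_coactInv, RationalAction.evalRight_coactInv,
      apply_coordinateAction_act, apply_coordinateAction_act, h, smul_eq_mul]
  change x (smulVia σ A ((coordinateAction π).coactInv a)) =
    r * x (smulVia σ A ((coordinateAction π).coactInv b))
  rw [hφ, hφ, hval, map_smul, map_smul, smul_eq_mul]

lemma apply_reynolds_eq_zero {x : Points k A} {a : A}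
    (h : ∀ y : Points k B, (x * inclusion π y) a = 0) : x (reynolds π σ a) = 0 := by
  rw [apply_reynolds_eq_smul (b := 0) (r := 0) (by simpa using h), zero_mul]

/-- On the coset `xH` the function `c` is the constant `x c`. -/
lemma reynolds_mul {a c : A} (hc : c ∈ invariantSubalgebra π) :
    reynolds π σ (a * c) = reynolds π σ a * c := by
  apply eq_of_forall_point (k := k)
  intro x
  rw [map_mul x.ofConv, mul_comm (x (reynolds π σ a))]
  refine apply_reynolds_eq_smul (π := π) (σ := σ) fun y => ?_
  rw [map_mul, (mem_invariants_coordinateAction π).1 hc x y, mul_comm]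

/-- A linear retraction onto a subalgebra maps the extension of an ideal into the ideal. -/
lemma retraction_mem_of_mem_map {S T : Type*} [CommRing S] [CommRing T] [Algebra S T]
    (p : T →ₗ[S] S) {I : Ideal S} {a : T} (ha : a ∈ I.map (algebraMap S T)) : p a ∈ I := by
  suffices h : ∀ r, p (r * a) ∈ I by simpa using h 1
  induction ha using Submodule.span_induction with
  | mem a ha =>
    obtain ⟨c, hc, rfl⟩ := ha
    intro r
    rw [mul_comm, ← Algebra.smul_def, map_smul, smul_eq_mul]
    exact I.mul_mem_right _ hc
  | zero => simp
  | add a b _ _ ha hb => intro r; rw [mul_add, map_add]; exact I.add_mem (ha r) (hb r)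
  | smul s a _ ha => intro r; rw [smul_eq_mul, ← mul_assoc]; exact ha _

/-- The projection of `k[G]` onto the algebra of invariants given by a total integral. -/
def IsTotalIntegral.retraction (hσ : IsTotalIntegral π σ) :
    A →ₗ[invariantSubalgebra π] invariantSubalgebra π where
  toFun a := ⟨reynolds π σ a, hσ.reynolds_mem a⟩
  map_add' a b := Subtype.ext (map_add _ a b)
  map_smul' c a := Subtype.ext (by
    change reynolds π σ ((c : A) * a) = c * reynolds π σ a
    rw [mul_comm, reynolds_mul c.2, mul_comm])

end Reynolds

/-! ### `G/H` as the variety of the algebra of invariants -/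

section QuotientByExactSubgroup

variable {k A B : Type u} [Field k] [CommRing A] [HopfAlgebra k A] [CommRing B] [HopfAlgebra k B]
variable {π : A →ₐc[k] B} {σ : B →ₗ[k] A}

/-- The coset `xH` is closed. -/
lemma exists_eq_mul_inclusion (hπ : Function.Surjective π) {x z : Points k A}
    (h : ∀ a : A, (∀ y : Points k B, (x * inclusion π y) a = 0) → z a = 0) :
    ∃ y : Points k B, z = x * inclusion π y := by
  have hker : ∀ a : A, π a = 0 → (x⁻¹ * z) a = 0 := by
    intro a ha
    rw [← apply_leftTranslation]
    refine h _ fun y => ?_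
    rw [apply_leftTranslation, inv_mul_cancel_left, inclusion_apply, ha, map_zero]
  let q : (A ⧸ RingHom.ker (π : A →ₐ[k] B)) ≃ₐ[k] B :=
    Ideal.quotientKerAlgEquivOfSurjective (f := (π : A →ₐ[k] B)) hπ
  let y : B →ₐ[k] k :=
    (Ideal.Quotient.liftₐ (RingHom.ker (π : A →ₐ[k] B)) (x⁻¹ * z).ofConv hker).comp
      (q.symm : B →ₐ[k] _)
  refine ⟨WithConv.toConv y, ?_⟩
  rw [← inv_mul_eq_iff_eq_mul]
  apply WithConv.ofConv_injective
  ext a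
  have hq : q.symm (π a) = Ideal.Quotient.mk _ a := by
    rw [AlgEquiv.symm_apply_eq]
    rfl
  change _ = Ideal.Quotient.liftₐ _ _ hker (q.symm (π a))
  rw [hq]
  rfl

variable [IsAlgClosed k] [Algebra.FiniteType k A] [IsReduced A]

lemma leftTranslation_mem (g : Points k A) {c : A} (hc : c ∈ invariantSubalgebra π) :
    leftTranslation g c ∈ invariantSubalgebra π := fun x => by
  rw [coordinateAction_act_leftTranslation, hc x]

lemma leftTranslation_leftTranslation_inv (g : Points k A) (a : A) :
    leftTranslation g (leftTranslation g⁻¹ a) = a :=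
  eq_of_forall_point (k := k) fun x => by
    rw [apply_leftTranslation, apply_leftTranslation, inv_mul_cancel_left]

/-- Restriction of points of `G` to the algebra of invariants. -/
def restrictPoint (π : A →ₐc[k] B) (x : Points k A) : Points k (invariantSubalgebra π) :=
  WithConv.toConv (x.ofConv.comp (invariantSubalgebra π).val)

/-- The map `G/H → Max k[G]^H`. -/
def quotientToPoints (π : A →ₐc[k] B) (q : HomogeneousSpace π) :
    Points k (invariantSubalgebra π) :=
  Quotient.lift (restrictPoint π) (by
    intro x y hxy
    obtain ⟨h, hh⟩ := QuotientGroup.leftRel_apply.1 hxy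
    apply WithConv.ofConv_injective
    ext c
    have := (mem_invariants_coordinateAction π).1 c.2 x h
    rw [hh, mul_inv_cancel_left] at this
    exact this.symm) q

lemma quotientToPoints_coe (x : Points k A) :
    quotientToPoints π (x : HomogeneousSpace π) = restrictPoint π x := rfl

variable [Algebra.FiniteType k B] [IsReduced B]

/-- The closed sets `G \ W` and `xH` are disjoint, so `1 = i + j` with `i` vanishing on the first
and `j` on the second. The Reynolds operator preserves both vanishings, so the average of `i` is an
invariant equal to `1` at `x`. -/
lemma IsTotalIntegral.exists_invariant_subset (hπ : Function.Surjective π)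
    (hσ : IsTotalIntegral π σ) {W : Set (Points k A)} (hWo : IsOpen W)
    (hW : ∀ x, ∀ y : Points k B, x * inclusion π y ∈ W ↔ x ∈ W) {x : Points k A} (hx : x ∈ W) :
    ∃ c ∈ invariantSubalgebra π, x c ≠ 0 ∧ ∀ y : Points k A, y c ≠ 0 → y ∈ W := by
  let I : Ideal A :=
    { carrier := {a | ∀ y : Points k A, y ∉ W → y a = 0}
      add_mem' := fun ha hb y hy => by rw [map_add, ha y hy, hb y hy, add_zero]
      zero_mem' := fun y _ => map_zero _
      smul_mem' := fun r a ha y hy => by rw [smul_eq_mul, map_mul, ha y hy, mul_zero] }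
  let J : Ideal A :=
    { carrier := {a | ∀ y : Points k B, (x * inclusion π y) a = 0}
      add_mem' := fun ha hb y => by rw [map_add, ha y, hb y, add_zero]
      zero_mem' := fun y => map_zero _
      smul_mem' := fun r a ha y => by rw [smul_eq_mul, map_mul, ha y, mul_zero] }
  have htop : I ⊔ J = ⊤ := by
    apply ideal_eq_top_of_forall_point (k := k)
    intro z
    by_contra! hz
    obtain ⟨y, rfl⟩ := exists_eq_mul_inclusion hπ (x := x) (z := z)
      fun a ha => hz a (Ideal.mem_sup_right ha)
    obtain ⟨s, hs, hsW⟩ := exists_ne_zero_subset hWo ((hW x y).2 hx)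
    refine hs (hz s (Ideal.mem_sup_left fun y hy => ?_))
    by_contra hys
    exact hy (hsW y hys)
  obtain ⟨i, hi, j, hj, hij⟩ := Submodule.mem_sup.1 ((Ideal.eq_top_iff_one _).1 htop)
  refine ⟨reynolds π σ i, hσ.reynolds_mem i, ?_, fun y hy => ?_⟩
  · have h₁ : x (reynolds π σ j) = 0 := apply_reynolds_eq_zero hj
    have h₂ : reynolds π σ i + reynolds π σ j = 1 := by
      rw [← map_add, hij, hσ.reynolds_one]
    have h₃ : x (reynolds π σ i) + x (reynolds π σ j) = 1 := by
      rw [← map_add, h₂, _root_.map_one]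
    rw [h₁, add_zero] at h₃
    rw [h₃]
    exact one_ne_zero
  · by_contra hyW
    exact hy (apply_reynolds_eq_zero fun h => hi _ (by rwa [hW]))

/-- By transitivity of left translation the translates of `f` have no common zero. Averaging the
resulting expression of `1` makes its coefficients invariant, so finite generation up to powers of
each translate of `f` becomes finite generation. -/
lemma IsTotalIntegral.fg_invariantSubalgebra (hσ : IsTotalIntegral π σ) :
    (invariantSubalgebra π).FG := by
  classical
  have : Nontrivial A := (Bialgebra.counitAlgHom k A).toRingHom.domain_nontrivial
  obtain ⟨f, hf, hf0, C₀, hC₀, hC₀fg, hC₀f⟩ :=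
    exists_fg_subalgebra_pow_mul_mem (invariantSubalgebra π)
  have htop : Ideal.span (Set.range fun g : Points k A => leftTranslation g f) = ⊤ := by
    obtain ⟨x₀, hx₀⟩ : ∃ x₀ : Points k A, x₀ f ≠ 0 := by
      by_contra! h
      exact hf0 (eq_of_forall_point (k := k) fun x => by rw [h, map_zero])
    apply ideal_eq_top_of_forall_point (k := k)
    intro x
    refine ⟨_, Ideal.subset_span ⟨x₀ * x⁻¹, rfl⟩, ?_⟩
    rwa [apply_leftTranslation, inv_mul_cancel_right]
  obtain ⟨l, hl⟩ := Finsupp.mem_ideal_span_range_iff_exists_finsupp.1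
    ((Ideal.eq_top_iff_one _).1 htop)
  have hone : ∑ g ∈ l.support, reynolds π σ (l g) * leftTranslation g f = 1 := by
    have := congrArg (reynolds π σ) hl
    rw [hσ.reynolds_one, Finsupp.sum, map_sum] at this
    rw [← this]
    exact Finset.sum_congr rfl fun g _ => (reynolds_mul (leftTranslation_mem g hf)).symm
  choose t ht using hC₀fg
  let s : Finset A := l.support.biUnion fun g =>
    insert (leftTranslation g f) (insert (reynolds π σ (l g)) (t.image (leftTranslation g)))
  let C₁ : Subalgebra k A := Algebra.adjoin k (s : Set A)
  have hs : ∀ g ∈ l.support, ∀ a ∈ insert (leftTranslation g f) (insert (reynolds π σ (l g))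
      (t.image (leftTranslation g))), a ∈ C₁ := fun g hg a ha =>
    Algebra.subset_adjoin (Finset.mem_coe.2 (Finset.mem_biUnion.2 ⟨g, hg, ha⟩))
  have hC₁ : C₁ ≤ invariantSubalgebra π := by
    rw [Algebra.adjoin_le_iff]
    intro a ha
    obtain ⟨g, -, ha⟩ := Finset.mem_biUnion.1 (Finset.mem_coe.1 ha)
    rw [Finset.mem_insert, Finset.mem_insert, Finset.mem_image] at ha
    rcases ha with rfl | rfl | ⟨b, hb, rfl⟩
    · exact leftTranslation_mem g hf
    · exact hσ.reynolds_mem _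
    · exact leftTranslation_mem g (hC₀ (ht ▸ Algebra.subset_adjoin hb))
  have hmap : ∀ g ∈ l.support, C₀.map (leftTranslation g) ≤ C₁ := by
    intro g hg
    rw [← ht, AlgHom.map_adjoin, Algebra.adjoin_le_iff]
    rintro _ ⟨b, hb, rfl⟩
    exact hs g hg _ (Finset.mem_insert_of_mem (Finset.mem_insert_of_mem
      (Finset.mem_image_of_mem _ hb)))
  suffices invariantSubalgebra π = C₁ by
    rw [this]
    exact Subalgebra.fg_adjoin_finset s
  refine le_antisymm (fun c hc => ?_) hC₁
  refine Subalgebra.mem_of_finsetSum_eq_one_of_pow_smul_mem C₁ (Finset.univ : Finset l.support)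
    (fun g => leftTranslation g.1 f) (fun g => reynolds π σ (l g.1)) ?_ (fun g => ?_) (fun g => ?_)
    c (fun g => ?_)
  · rw [← hone, ← Finset.sum_coe_sort l.support]
  · exact hs g g.2 _ (Finset.mem_insert_self _ _)
  · exact hs g g.2 _ (Finset.mem_insert_of_mem (Finset.mem_insert_self _ _))
  · obtain ⟨n, hn⟩ := hC₀f _ (leftTranslation_mem (g : Points k A)⁻¹ hc)
    refine ⟨n, hmap g g.2 ⟨_, hn, ?_⟩⟩
    change leftTranslation (g : Points k A) _ = _
    rw [map_mul, map_pow, leftTranslation_leftTranslation_inv, smul_eq_mul]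

/-- Injectivity: cosets are closed, so an invariant separates two of them. Surjectivity: the
Reynolds retraction keeps the extension to `k[G]` of a maximal ideal of invariants proper, and a
zero of it lies over the given point. -/
lemma IsTotalIntegral.quotientToPoints_bijective (hπ : Function.Surjective π)
    (hσ : IsTotalIntegral π σ) : Function.Bijective (quotientToPoints π) := by
  constructor
  · intro p q hpq
    obtain ⟨x, rfl⟩ := QuotientGroup.mk_surjective p
    obtain ⟨y, rfl⟩ := QuotientGroup.mk_surjective q
    by_contra hne
    let W : Set (Points k A) := {z | (y : HomogeneousSpace π) ≠ z}
    have hWo : IsOpen W := by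
      rw [isOpen_iff_forall_mem_open]
      intro z hz
      by_contra hcon
      apply hz
      have : ∃ h : Points k B, z = y * inclusion π h := by
        apply exists_eq_mul_inclusion hπ
        intro a ha
        by_contra hza
        refine hcon ⟨{w | w a ≠ 0}, fun w hw hyw => hw ?_, isOpen_ne_zero a, hza⟩
        obtain ⟨h, hh⟩ := QuotientGroup.eq.1 hyw
        have := ha h
        rwa [hh, mul_inv_cancel_left] at this
      obtain ⟨h, rfl⟩ := this
      exact (coe_mul_inclusion π y h).symm
    obtain ⟨c, hc, hxc, hcW⟩ := hσ.exists_invariant_subset hπ hWo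
      (fun z h => by change _ ≠ _ ↔ _ ≠ _; rw [coe_mul_inclusion]) (x := x)
      (fun h => hne h.symm)
    have h₁ : x c = y c := congrArg (fun p : Points k (invariantSubalgebra π) => p ⟨c, hc⟩) hpq
    exact hcW y (h₁ ▸ hxc) rfl
  · intro y
    have hne : (RingHom.ker y.ofConv).map (algebraMap (invariantSubalgebra π) A) ≠ ⊤ := by
      intro htop
      have h1 : hσ.retraction 1 ∈ RingHom.ker y.ofConv :=
        retraction_mem_of_mem_map hσ.retraction (htop ▸ Submodule.mem_top)
      have h₁ : hσ.retraction 1 = 1 := Subtype.ext hσ.reynolds_one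
      rw [h₁, RingHom.mem_ker, _root_.map_one] at h1
      exact one_ne_zero h1
    obtain ⟨x, hx⟩ := exists_point_of_ne_top (k := k) hne
    refine ⟨(x : HomogeneousSpace π), ?_⟩
    apply WithConv.ofConv_injective
    ext c
    have h₁ : x (algebraMap (invariantSubalgebra π) A (c - algebraMap k _ (y c))) = 0 :=
      hx _ (Ideal.mem_map_of_mem _ (by simp [RingHom.mem_ker]))
    have h₂ : algebraMap (invariantSubalgebra π) A (c - algebraMap k _ (y c)) =
        (c : A) - algebraMap k A (y c) := rfl
    rw [h₂, map_sub, AlgHom.commutes, sub_eq_zero] at h₁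
    exact h₁

lemma IsTotalIntegral.isOpen_preimage_quotientToPoints (hπ : Function.Surjective π)
    (hσ : IsTotalIntegral π σ) (U : Set (Points k (invariantSubalgebra π))) :
    IsOpen (quotientToPoints π ⁻¹' U) ↔ IsOpen U := by
  constructor
  · intro hU
    have hWo : IsOpen (restrictPoint π ⁻¹' U) := isOpen_coinduced.1 hU
    rw [isOpen_iff_forall_mem_open]
    intro y hy
    obtain ⟨q, rfl⟩ := (hσ.quotientToPoints_bijective hπ).2 y
    obtain ⟨x, rfl⟩ := QuotientGroup.mk_surjective q
    obtain ⟨c, hc, hxc, hcW⟩ := hσ.exists_invariant_subset hπ hWo (fun z h => by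
      rw [Set.mem_preimage, Set.mem_preimage, ← quotientToPoints_coe, ← quotientToPoints_coe,
        coe_mul_inclusion]) (x := x) hy
    refine ⟨{z | z ⟨c, hc⟩ ≠ 0}, fun z hz => ?_, isOpen_ne_zero _, hxc⟩
    obtain ⟨q, rfl⟩ := (hσ.quotientToPoints_bijective hπ).2 z
    obtain ⟨w, rfl⟩ := QuotientGroup.mk_surjective q
    exact hcW w hz
  · intro hU
    refine isOpen_coinduced.2 ?_
    change IsOpen (restrictPoint π ⁻¹' U)
    rw [isOpen_iff_forall_mem_open]
    intro x hx
    obtain ⟨s, hs, hsU⟩ := exists_ne_zero_subset hU hx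
    exact ⟨{z | z (s : A) ≠ 0}, fun z hz => hsU _ hz, isOpen_ne_zero _, hs⟩

lemma IsTotalIntegral.isRegularOn_iff (hπ : Function.Surjective π) (hσ : IsTotalIntegral π σ)
    {U : Set (Points k (invariantSubalgebra π))} (hU : IsOpen U)
    (f : Points k (invariantSubalgebra π) → k) :
    IsRegularOn U f ↔ IsRegularOn (restrictPoint π ⁻¹' U) (f ∘ restrictPoint π) := by
  constructor
  · intro hf x hx
    obtain ⟨a, s, hs, has⟩ := hf _ hx
    exact ⟨a, s, hs, fun y hy hys => has _ hy hys⟩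
  · intro hf y hy
    obtain ⟨c, hc, hcU⟩ := exists_ne_zero_subset hU hy
    obtain ⟨n, a, ha⟩ := hf.exists_eq_div_pow (c := (c : A)) fun z hz => hcU _ hz
    -- As a function on `G`, `a` is `c ^ (n + 1)` times the pullback of `f`, hence constant on
    -- cosets.
    have hainv : a ∈ invariantSubalgebra π := by
      refine (mem_invariants_coordinateAction π).2 fun x h => ?_
      rw [← ha, ← ha, (mem_invariants_coordinateAction π).1 c.2 x h, Function.comp_apply,
        Function.comp_apply, ← quotientToPoints_coe, coe_mul_inclusion]
      rfl
    refine ⟨⟨a, hainv⟩, c ^ (n + 1), by rw [map_pow]; exact pow_ne_zero _ hc, fun z _ hz => ?_⟩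
    obtain ⟨q, rfl⟩ := (hσ.quotientToPoints_bijective hπ).2 z
    obtain ⟨w, rfl⟩ := QuotientGroup.mk_surjective q
    rw [eq_div_iff hz]
    have := ha w
    refine Eq.trans ?_ this
    rw [map_pow, pow_succ]
    change f (restrictPoint π w) * (w (c : A) ^ n * w (c : A)) =
      w (c : A) ^ n * f (restrictPoint π w) * w (c : A)
    ring

lemma IsTotalIntegral.isAffineHomogeneousSpace (hπ : Function.Surjective π)
    (hσ : IsTotalIntegral π σ) : IsAffineHomogeneousSpace π :=
  ⟨invariantSubalgebra π, inferInstance, inferInstance,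
    (Subalgebra.fg_iff_finiteType _).1 hσ.fg_invariantSubalgebra,
    isReduced_of_injective (invariantSubalgebra π).val Subtype.val_injective,
    (Equiv.ofBijective _ (hσ.quotientToPoints_bijective hπ)).toHomeomorph
      (hσ.isOpen_preimage_quotientToPoints hπ),
    fun _ hU f => hσ.isRegularOn_iff hπ hU f⟩

end QuotientByExactSubgroup

end

end Observability

theorem theorem4p6 {k A B : Type u} [Field k] [IsAlgClosed k]
    [CommRing A] [HopfAlgebra k A] [Algebra.FiniteType k A] [IsReduced A]
    [CommRing B] [HopfAlgebra k B] [Algebra.FiniteType k B] [IsReduced B]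
    (π : A →ₐc[k] B) (hπ : Function.Surjective π) :
    List.TFAE [
      Observability.IsExactSubgroup π,
      Observability.IsAffineHomogeneousSpace π,
      ∃ σ : B →ₗ[k] A, Observability.IsTotalIntegral π σ] := by
  tfae_have 1 → 3 := fun h => h.exists_isTotalIntegral
  tfae_have 3 → 1 := fun ⟨_, hσ⟩ => hσ.hasLocalIntegrals.isExactSubgroup
  tfae_have 2 → 1 := fun h => (h.hasLocalIntegrals hπ).isExactSubgroup
  tfae_have 3 → 2 := fun ⟨_, hσ⟩ => hσ.isAffineHomogeneousSpace hπ
  tfae_finish
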